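/- All monoids are commutative and written additively. For a monoid $P$, let $P^*$ be its group of units, $P^{\rm gp}$ its group completion, and $\overline{P}=P/P^*$ its sharpening. $P$ is *fine* if it is finitely generated and $P\to P^{\rm gp}$ is injective. A module over a monoid $Q$ is a set with a $Q$-action. A subset $S$ of a $Q$-module $M$ generates $M$ (resp. is a $Q$-basis of $M$) if every $m\in M$ is of the form $m=q+s$ for some (resp. for exactly one) pair $(q,s)\in Q\times S$. $M$ is free if it has a basis, and flat if it is a filtered direct limit of free modules. A map $h:Q\to P$ of monoids makes $P$ a $Q$-module by $q+p:=h(q)+p$; $h$ is *finite* (resp. *flat*) if $P$ is generated by a finite subset (resp. is flat) as a $Q$-module, *local* if $h^{-1}(P^*)=Q^*$, and *reduced* if the ideal $I=h(Q\setminus Q^*)+P$ of $P$ is saturated, i.e. $np\in I$ with $n>0$ implies $p\in I$. $P/Q$ denotes the cokernel of $h$ in the category of monoids, $h^*:Q^*\to P^*$ and $\overline h:\overline Q\to\overline P$ are the induced maps, $\operatorname{Spec} P$ is the set of faces of $P$ (submonoids $F$ such that $p+p'\in F$ implies $p,p'\in F$) with the topology generated by the sets $\{F : p\in F\}$, $p\in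 P$, and $\operatorname{Spec} h : \operatorname{Spec} P\to\operatorname{Spec} Q$ is $F\mapsto h^{-1}(F)$. For a field $k$, $k[h]:k[Q]\to k[P]$ is the induced map of monoid algebras. A *finite étale cover* is a finite, étale and surjective map of schemes. **Theorem.** For a map $h:Q\to P$ of fine monoids, the following are equivalent: 1. $h^*$ is injective with finite cokernel, and the square formed by $h^*:Q^*\to P^*$, $h:Q\to P$ and the inclusions $Q^*\to Q$, $P^*\to P$ is a pushout diagram of monoids. 2. $h$ is injective, $\overline h:\overline Q\to\overline P$ is an isomorphism, and $P/Q$ is finite. 3. There is a finite subset $S\subseteq P^*$ which is a $Q$-basis for $P$, and any other $Q$-basis $S'\subseteq P$ for $P$ is contained in $P^*$ and has the same cardinality as $S$. 4. There is a finite subset $S\subseteq P^*$ which is a $Q$-basis for $P$. 5. $\operatorname{Spec} h$ is a homeomorphism, and $\operatorname{Spec} k[h]$ is a finite étale cover for every field $k$ of characteristic zero. 6. $\operatorname{Spec} k[h]$ is a finite étale cover for every field $k$ of characteristic zero. 7. There is a field $k$ for which $\operatorname{Spec} k[h]$ is a finite étale cover. - (7′) Equivalently: $h^*$ is injective and there is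 a field $k$ for which the ring map $k[h]$ is finite étale. 8. $h$ is finite, flat, reduced and local. 9. $h$ is finite, flat and reduced. -/

import Mathlib

open CategoryTheory

universe u v w

namespace CZE

/-! ### Fine monoids

Monoids are commutative and written additively. The unit group of `P` is `AddUnits P`, and the map
of unit groups induced by `h : Q →+ P` is `AddUnits.map h`. -/

/-- A commutative monoid is fine iff it is finitely generated and integral, i.e. the canonical map
to its group completion is injective. -/
structure IsFine (P : Type u) [AddCommMonoid P] : Prop where
  fg : AddMonoid.FG P
  integral : Function.Injective (Algebra.GrothendieckAddGroup.of (M := P))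

/-! ### Quotients and sharpening -/

/-- The congruence on `P` whose quotient is the quotient monoid `P / S`, the cokernel of the
inclusion of the submonoid `S`. -/
def quotientCon {P : Type u} [AddCommMonoid P] (S : AddSubmonoid P) : AddCon P where
  r p p' := ∃ s ∈ S, ∃ s' ∈ S, s + p = s' + p'
  iseqv :=
    { refl := fun _ => ⟨0, S.zero_mem, 0, S.zero_mem, rfl⟩
      symm := by
        rintro _ _ ⟨s, hs, s', hs', e⟩
        exact ⟨s', hs', s, hs, e.symm⟩
      trans := by
        rintro x y z ⟨s, hs, s', hs', e⟩ ⟨t, ht, t', ht', e'⟩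
        refine ⟨t + s, S.add_mem ht hs, s' + t', S.add_mem hs' ht', ?_⟩
        rw [add_assoc, e, add_left_comm, e', add_assoc] }
  add' := by
    rintro a b c d ⟨s, hs, s', hs', e⟩ ⟨t, ht, t', ht', e'⟩
    refine ⟨s + t, S.add_mem hs ht, s' + t', S.add_mem hs' ht', ?_⟩
    rw [add_add_add_comm, e, e', add_add_add_comm]

/-- `quotientCon S` is the smallest congruence that identifies all elements of `S` with `0`. -/
theorem quotientCon_eq_addConGen {P : Type u} [AddCommMonoid P] (S : AddSubmonoid P) :
    quotientCon S = addConGen (fun p p' => p ∈ S ∧ p' = 0) := by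
  apply le_antisymm
  · rintro p p' ⟨s, hs, s', hs', e⟩
    have key : ∀ t ∈ S, ∀ x : P, addConGen (fun p p' => p ∈ S ∧ p' = 0) (t + x) x := by
      intro t ht x
      have h0 : addConGen (fun p p' => p ∈ S ∧ p' = 0) t 0 := AddConGen.Rel.of _ _ ⟨ht, rfl⟩
      simpa using (addConGen (fun p p' => p ∈ S ∧ p' = 0)).add h0 (AddCon.refl _ x)
    have h1 := key s hs p
    rw [e] at h1
    exact (AddCon.symm _ h1).trans (key s' hs' p')
  · refine AddCon.addConGen_le.2 ?_
    rintro p _ ⟨hp, rfl⟩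
    exact ⟨0, S.zero_mem, p, hp, by simp⟩

/-- The sharpening `P / P*` of `P`. -/
abbrev Sharpening (P : Type u) [AddCommMonoid P] : Type u :=
  (quotientCon (IsAddUnit.addSubmonoid P)).Quotient

/-- The map of sharpenings induced by a map of monoids. -/
def sharpeningMap {Q P : Type u} [AddCommMonoid Q] [AddCommMonoid P] (h : Q →+ P) :
    Sharpening Q →+ Sharpening P :=
  AddCon.lift _ ((AddCon.mk' (quotientCon (IsAddUnit.addSubmonoid P))).comp h) (by
    rintro x y ⟨s, hs, s', hs', e⟩
    refine (AddCon.eq _).2 ⟨h s, IsAddUnit.map h hs, h s', IsAddUnit.map h hs', ?_⟩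
    rw [← map_add, e, map_add])

/-- The quotient monoid `P / Q` of a map of monoids `h : Q →+ P`, i.e. its cokernel. -/
abbrev Coker {Q P : Type u} [AddCommMonoid Q] [AddCommMonoid P] (h : Q →+ P) : Type u :=
  (quotientCon (AddMonoidHom.mrange h)).Quotient

/-! ### Modules over a monoid -/

/-- A module over the monoid `Q` is a set with an action of `Q`. -/
abbrev Mod (Q : Type u) [AddCommMonoid Q] : Type (u + 1) :=
  Action (Type u) (Multiplicative Q)

section Mod

variable {Q : Type u} [AddCommMonoid Q]

/-- `S` generates `M`: every element of `M` is of the form `q + s` with `s ∈ S`. -/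
def Generates (M : Mod Q) (S : Set M.V) : Prop :=
  Function.Surjective fun x : Q × S => M.ρ (Multiplicative.ofAdd x.1) (x.2 : M.V)

/-- `S` is a basis of `M`: every element of `M` is uniquely of the form `q + s` with `s ∈ S`. -/
def IsBasis (M : Mod Q) (S : Set M.V) : Prop :=
  Function.Bijective fun x : Q × S => M.ρ (Multiplicative.ofAdd x.1) (x.2 : M.V)

/-- Finitely generated modules. -/
def ModFinite (M : Mod Q) : Prop := ∃ S : Set M.V, S.Finite ∧ Generates M S

/-- Free modules, on a basis of any size. -/
def ModFree : ObjectProperty (Mod Q) := fun M => ∃ S : Set M.V, IsBasis M S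

/-- Flat modules: the filtered colimits of free modules. -/
def ModFlat : ObjectProperty (Mod Q) := ObjectProperty.ind.{u} ModFree

end Mod

section Hom

variable {Q P : Type u} [AddCommMonoid Q] [AddCommMonoid P]

/-- The action of `Q` on `P` through `h`, namely `q + p := h q + p`. -/
@[reducible] def homAction (h : Q →+ P) : MulAction (Multiplicative Q) P where
  smul q p := h q.toAdd + p
  one_smul p := by
    change h 0 + p = p
    rw [map_zero, zero_add]
  mul_smul a b p := by
    change h (a.toAdd + b.toAdd) + p = h a.toAdd + (h b.toAdd + p)
    rw [map_add, add_assoc]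

/-- `P` as a `Q`-module through `h`. -/
abbrev asModule (h : Q →+ P) : Mod Q :=
  @Action.ofMulAction (Multiplicative Q) P _ (homAction h)

/-- `S ⊆ P` is a `Q`-basis for `P`. -/
def IsBasisFor (h : Q →+ P) (S : Set P) : Prop := IsBasis (asModule h) S

theorem isBasisFor_iff (h : Q →+ P) (S : Set P) :
    IsBasisFor h S ↔ Function.Bijective fun x : Q × S => h x.1 + (x.2 : P) := Iff.rfl

/-- `h` is finite: `P` is a finitely generated `Q`-module. -/
def IsFiniteHom (h : Q →+ P) : Prop := ModFinite (asModule h)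

/-- `h` is flat: `P` is a flat `Q`-module. -/
def IsFlatHom (h : Q →+ P) : Prop := ModFlat (asModule h)

/-- `h` is local: the preimage of `P*` is `Q*`. -/
def IsLocalMap (h : Q →+ P) : Prop := ∀ q : Q, IsAddUnit (h q) ↔ IsAddUnit q

/-- The ideal `h(Q \ Q*) + P` of `P` generated by the image of the nonunits of `Q`. -/
def nonunitIdeal (h : Q →+ P) : Set P := {p | ∃ q : Q, ¬ IsAddUnit q ∧ ∃ p' : P, p = h q + p'}

/-- An ideal `I` is saturated if `n • p ∈ I` with `n > 0` implies `p ∈ I`. -/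
def IsSaturated (I : Set P) : Prop := ∀ (n : ℕ) (p : P), 0 < n → n • p ∈ I → p ∈ I

/-- `h` is reduced. -/
def IsReducedHom (h : Q →+ P) : Prop := IsSaturated (nonunitIdeal h)

end Hom

/-! ### The spectrum of a monoid -/

/-- The points of the spectrum of `P` are the faces of `P`: the submonoids `F` such that
`p + p' ∈ F` implies `p, p' ∈ F`. -/
@[ext]
structure Spec (P : Type u) [AddCommMonoid P] where
  face : AddSubmonoid P
  mem_of_add_mem : ∀ p p' : P, p + p' ∈ face → p ∈ face ∧ p' ∈ face

/-- The Zariski topology, with basic open sets `{F | p ∈ F}`. -/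
instance (P : Type u) [AddCommMonoid P] : TopologicalSpace (Spec P) :=
  TopologicalSpace.generateFrom (Set.range fun p : P => {F : Spec P | p ∈ F.face})

/-- The map of spectra induced by `h`, which is the preimage of faces. -/
def specMap {Q P : Type u} [AddCommMonoid Q] [AddCommMonoid P] (h : Q →+ P) (F : Spec P) :
    Spec Q where
  face := F.face.comap h
  mem_of_add_mem p p' hp := F.mem_of_add_mem (h p) (h p') (by
    simpa only [AddSubmonoid.mem_comap, map_add] using hp)

/-! ### Monoid algebras -/

/-- The ring map `k[h] : k[Q] → k[P]`. -/
noncomputable def algMap (k : Type v) [Field k] {Q P : Type u} [AddCommMonoid Q]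
    [AddCommMonoid P] (h : Q →+ P) : AddMonoidAlgebra k Q →+* AddMonoidAlgebra k P :=
  AddMonoidAlgebra.mapDomainRingHom k h

/-- The map of schemes `Spec k[h] : Spec k[P] ⟶ Spec k[Q]`. -/
noncomputable def specAlgMap (k : Type v) [Field k] {Q P : Type u} [AddCommMonoid Q]
    [AddCommMonoid P] (h : Q →+ P) :
    AlgebraicGeometry.Spec (CommRingCat.of (AddMonoidAlgebra k P)) ⟶
      AlgebraicGeometry.Spec (CommRingCat.of (AddMonoidAlgebra k Q)) :=
  AlgebraicGeometry.Spec.map (CommRingCat.ofHom (algMap k h))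

/-- A finite étale ring map. -/
def IsFiniteEtale {A B : Type w} [CommRing A] [CommRing B] (f : A →+* B) : Prop :=
  f.Finite ∧ f.Etale

/-- A finite étale cover: a finite, étale and surjective map of schemes. -/
def IsFiniteEtaleCover {X Y : AlgebraicGeometry.Scheme.{w}} (f : X ⟶ Y) : Prop :=
  AlgebraicGeometry.IsFinite f ∧ AlgebraicGeometry.Etale f ∧ AlgebraicGeometry.Surjective f

end CZE

namespace CZE

/-! Everything is routed through one condition: `P` has a finite `Q`-basis made of units. Such a
basis is a set of representatives of `P*/h(Q*)`, and it says that every element of `P` is `h q + v`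
with `v` a unit, where the pair `(q, v)` is unique up to `Q*`. The pushout property, the isomorphism
of sharpenings, the homeomorphism of spectra, flatness, reducedness and locality can all be read off
from this. Conversely, `exists_basis_of_units` recovers the basis from this decomposition, which the
pushout and sharpening conditions provide.

For finite flat maps, the equational form of flatness turns a minimal finite generating set into a
basis (`IsEquationallyFlat.exists_isBasisFor`); it remains to see that its elements `s` are units.
By finiteness some `n • s = h q` with `n > 0`, and `q` is a nonunit if `s` is. If `h` is reduced,
`s` then lies in the ideal generated by the nonunits of `Q`, against uniqueness of coordinates. If
`k[h]` is étale, the monomial of `s` is nilpotent, hence zero, in the reduced fibre over the point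
where exactly the nonunit monomials vanish, yet a basis element does not vanish there. Finiteness
and flatness of `k[h]` pass to `h` by looking at supports.

Étaleness of `k[h]` in characteristic zero is infinitesimal lifting: `k[P]` arises from `k[Q]` by
adjoining `n`-th roots of unit monomials, `n` being the order of `P*/h(Q*)`, and such roots lift
uniquely along square-zero ideals when `n` is invertible. -/

theorem IsFine.isCancelAdd {P : Type u} [AddCommMonoid P] (hP : IsFine P) : IsCancelAdd P :=
  have : IsLeftCancelAdd P := ⟨fun a b c e => hP.integral (by
    have e' := congrArg (Algebra.GrothendieckAddGroup.of (M := P)) e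
    simpa only [map_add, add_right_inj] using e')⟩
  AddCommMagma.IsLeftCancelAdd.toIsCancelAdd P

theorem isAddUnit_of_add {P : Type u} [AddCommMonoid P] {a b : P} (hab : IsAddUnit (a + b)) :
    IsAddUnit a :=
  isAddUnit_of_add_isAddUnit_left hab

/-! ### Bases of `P` as a `Q`-module, and bases of units -/

section Hom

variable {Q P : Type u} [AddCommMonoid Q] [AddCommMonoid P] {h : Q →+ P} {S : Set P}

theorem IsBasisFor.exists_rep (hS : IsBasisFor h S) (p : P) : ∃ q, ∃ s ∈ S, h q + s = p := by
  obtain ⟨⟨q, s⟩, e⟩ := hS.2 p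
  exact ⟨q, s.1, s.2, e⟩

theorem IsBasisFor.unique (hS : IsBasisFor h S) {q q' : Q} {s s' : P} (hs : s ∈ S) (hs' : s' ∈ S)
    (e : h q + s = h q' + s') : q = q' ∧ s = s' := by
  have := @hS.1 (q, ⟨s, hs⟩) (q', ⟨s', hs'⟩) e
  exact ⟨congrArg Prod.fst this, congrArg (fun x => x.2.1) this⟩

theorem isBasisFor_of_exists_rep (hex : ∀ p : P, ∃ q, ∃ s ∈ S, h q + s = p)
    (huniq : ∀ q q' : Q, ∀ s ∈ S, ∀ s' ∈ S, h q + s = h q' + s' → q = q' ∧ s = s') :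
    IsBasisFor h S := by
  rw [isBasisFor_iff]
  constructor
  · rintro ⟨q, s, hs⟩ ⟨q', s', hs'⟩ e
    obtain ⟨rfl, rfl⟩ := huniq q q' s hs s' hs' e
    rfl
  · intro p
    obtain ⟨q, s, hs, e⟩ := hex p
    exact ⟨(q, ⟨s, hs⟩), e⟩

theorem IsBasisFor.injective (hS : IsBasisFor h S) : Function.Injective h := by
  intro q q' e
  obtain ⟨_, s, hs, _⟩ := hS.exists_rep 0
  exact (hS.unique hs hs (by rw [e] : h q + s = h q' + s)).1

/-- A map with a basis is local. -/
theorem IsBasisFor.isLocalMap (hS : IsBasisFor h S) : IsLocalMap h := by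
  refine fun q => ⟨fun hq => ?_, fun hq => hq.map h⟩
  obtain ⟨p, hp⟩ := hq.exists_neg
  -- Any basis element `s` serves: translating the expansion of `p + s` by `h q = -p` expands `s`
  -- itself, so its coefficient `q + q'` is `0`.
  obtain ⟨_, s, hs, _⟩ := hS.exists_rep 0
  obtain ⟨q', s', hs', e⟩ := hS.exists_rep (p + s)
  have key : h (q + q') + s' = h 0 + s := by
    rw [map_add, add_assoc, e, ← add_assoc, hp, map_zero]
  have := (hS.unique hs' hs key).1
  exact isAddUnit_of_add (this ▸ isAddUnit_zero)

theorem IsBasisFor.exists_rep_unit (hS : IsBasisFor h S) {p : P}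
    (hp : IsAddUnit p) : ∃ q, IsAddUnit q ∧ ∃ s ∈ S, h q + s = p := by
  obtain ⟨q, s, hs, rfl⟩ := hS.exists_rep p
  exact ⟨q, (hS.isLocalMap q).1 (isAddUnit_of_add hp), s, hs, rfl⟩

/-- Two ways to write an element as the sum of an element of `Q` and a unit of `P` differ by a
unit of `Q`. -/
theorem IsBasisFor.exists_unit (hS : IsBasisFor h S) {q q' : Q}
    {v v' : P} (hv : IsAddUnit v) (hv' : IsAddUnit v') (e : h q + v = h q' + v') :
    ∃ u, IsAddUnit u ∧ q = u + q' := by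
  obtain ⟨a, ha, s, hs, rfl⟩ := hS.exists_rep_unit hv
  obtain ⟨b, hb, s', hs', rfl⟩ := hS.exists_rep_unit hv'
  rw [← add_assoc, ← add_assoc, ← map_add, ← map_add] at e
  obtain ⟨e1, -⟩ := hS.unique hs hs' e
  obtain ⟨c, hc⟩ := ha.exists_neg
  refine ⟨b + c, hb.add ⟨⟨c, a, by rw [add_comm, hc], hc⟩, rfl⟩, ?_⟩
  calc q = (q + a) + c := by rw [add_assoc, hc, add_zero]
    _ = b + c + q' := by rw [e1]; abel

/-- Expanding `s'` over `S` and the result back over `S'` returns `s'`, so the two coefficients sum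
to `0`. Hence `s'` is a unit translate of an element of `S`. -/
theorem IsBasisFor.isAddUnit_of_isBasisFor (hS : IsBasisFor h S) (hu : ∀ s ∈ S, IsAddUnit s)
    {S' : Set P} (hS' : IsBasisFor h S') : ∀ s ∈ S', IsAddUnit s := by
  intro s' hs'
  obtain ⟨q, s, hs, e⟩ := hS.exists_rep s'
  obtain ⟨q', t, ht, e'⟩ := hS'.exists_rep s
  have key : h (q + q') + t = h 0 + s' := by
    rw [map_add, add_assoc, e', e, map_zero, zero_add]
  have := (hS'.unique ht hs' key).1
  rw [← e]
  exact ((isAddUnit_of_add (this ▸ isAddUnit_zero)).map h).add (hu s hs)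

/-- Each element of `S'` is a `Q*`-translate of an element of `S`, and two elements of `S'` with the
same partner are `Q*`-translates of each other, hence equal. -/
theorem IsBasisFor.mk_le_mk (hS : IsBasisFor h S) (hu : ∀ s ∈ S, IsAddUnit s)
    {S' : Set P} (hS' : IsBasisFor h S') : Cardinal.mk S' ≤ Cardinal.mk S := by
  have hu' := hS.isAddUnit_of_isBasisFor hu hS'
  choose q hq s hs e using fun x : S' => hS.exists_rep_unit (hu' x x.2)
  refine Cardinal.mk_le_of_injective (f := fun x => (⟨s x, hs x⟩ : S)) ?_
  intro x y hxy
  have hxy : s x = s y := congrArg Subtype.val hxy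
  have key : h (q y) + x.1 = h (q x) + y.1 := by
    rw [← e x, ← e y, hxy, add_left_comm]
  exact Subtype.ext (hS'.unique x.2 y.2 key).2

theorem IsBasisFor.isReducedHom (hS : IsBasisFor h S) (hu : ∀ s ∈ S, IsAddUnit s) :
    IsReducedHom h := by
  rintro n p hn ⟨q, hq, p', e⟩
  obtain ⟨a, s, hs, rfl⟩ := hS.exists_rep p
  refine ⟨a, fun ha => hq ?_, s, rfl⟩
  have h1 : IsAddUnit (n • (h a + s)) := ((ha.map h).add (hu s hs)).nsmul n
  rw [e] at h1
  exact (hS.isLocalMap q).1 (isAddUnit_of_add h1)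

theorem IsBasisFor.isFiniteHom (hS : IsBasisFor h S) (hfin : S.Finite) : IsFiniteHom h :=
  ⟨S, hfin, hS.2⟩

theorem IsBasisFor.isFlatHom (hS : IsBasisFor h S) : IsFlatHom h :=
  ObjectProperty.le_ind _ _ ⟨S, hS⟩

/-! ### The combinatorial criterion for a basis of units -/

/-- A criterion for a finite basis of units, in terms of elements. -/
theorem exists_basis_of_units [IsCancelAdd P] [IsCancelAdd Q]
    (hinj : Function.Injective h)
    (hfin : Finite (AddUnits P ⧸ (AddUnits.map h).range))
    (hgen : ∀ p : P, ∃ q, ∃ v : AddUnits P, h q + v = p)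
    (huniq : ∀ (q q' : Q) (v v' : AddUnits P), h q + v = h q' + v' →
      ∃ u : AddUnits Q, q = u + q') :
    ∃ S : Set P, S.Finite ∧ (∀ s ∈ S, IsAddUnit s) ∧ IsBasisFor h S := by
  -- The basis consists of one representative for each coset of `h(Q*)` in `P*`.
  let f : AddUnits P ⧸ (AddUnits.map h).range → P := fun x => (Quotient.out x : AddUnits P)
  refine ⟨Set.range f, Set.finite_range f, ?_, isBasisFor_of_exists_rep ?_ ?_⟩
  · rintro _ ⟨x, rfl⟩
    exact ⟨_, rfl⟩
  · intro p
    obtain ⟨q, v, rfl⟩ := hgen p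
    have : (QuotientAddGroup.mk (Quotient.out (QuotientAddGroup.mk v :
        AddUnits P ⧸ (AddUnits.map h).range)) : AddUnits P ⧸ (AddUnits.map h).range) =
        QuotientAddGroup.mk v := Quotient.out_eq _
    obtain ⟨u, hu⟩ := QuotientAddGroup.eq.1 this
    refine ⟨q + u, _, ⟨QuotientAddGroup.mk v, rfl⟩, ?_⟩
    have h2 : v = AddUnits.map h u + Quotient.out (QuotientAddGroup.mk v :
        AddUnits P ⧸ (AddUnits.map h).range) := by
      rw [hu]; abel
    conv_rhs => rw [h2]
    simp [f, add_assoc]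
  · rintro q q' _ ⟨x, rfl⟩ _ ⟨y, rfl⟩ e
    obtain ⟨u, rfl⟩ := huniq q q' _ _ e
    have e1 : AddUnits.map h u + Quotient.out x = Quotient.out y := by
      ext
      have : h q' + (h u + (Quotient.out x : AddUnits P)) = h q' + (Quotient.out y : AddUnits P) := by
        rw [← e, map_add]; simp only [f]; abel
      exact add_left_cancel this
    have hxy : x = y := by
      rw [← Quotient.out_eq x, ← Quotient.out_eq y]
      refine QuotientAddGroup.eq.2 ⟨u, ?_⟩
      rw [← e1]; abel
    subst hxy
    refine ⟨hinj (add_right_cancel e), rfl⟩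

/-! ### Sharpenings and cokernels -/

theorem quotientCon_units_iff {p p' : P} :
    quotientCon (IsAddUnit.addSubmonoid P) p p' ↔ ∃ v : AddUnits P, p = v + p' := by
  constructor
  · rintro ⟨_, ⟨s, rfl⟩, _, ⟨s', rfl⟩, e⟩
    refine ⟨-s + s', ?_⟩
    rw [AddUnits.val_add, add_assoc, ← e, ← add_assoc, AddUnits.neg_add, zero_add]
  · rintro ⟨v, e⟩
    exact ⟨0, isAddUnit_zero, v, ⟨v, rfl⟩, by rw [zero_add, e]⟩

theorem IsBasisFor.bijective_sharpeningMap (hS : IsBasisFor h S) (hu : ∀ s ∈ S, IsAddUnit s) :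
    Function.Bijective (sharpeningMap h) := by
  constructor
  · intro x y
    induction x using AddCon.induction_on with | _ x
    induction y using AddCon.induction_on with | _ y
    intro e
    obtain ⟨s, hs, s', hs', e⟩ := (AddCon.eq _).1 (show ((h x : P) : Sharpening P) = (h y : P) from e)
    rw [add_comm s, add_comm s'] at e
    obtain ⟨u, ⟨u, rfl⟩, rfl⟩ := hS.exists_unit hs hs' e
    exact (AddCon.eq _).2 (quotientCon_units_iff.2 ⟨u, rfl⟩)
  · intro y
    induction y using AddCon.induction_on with | _ y
    obtain ⟨q, s, hs, rfl⟩ := hS.exists_rep y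
    refine ⟨(q : Sharpening Q), (AddCon.eq _).2 ⟨s, hu s hs, 0, isAddUnit_zero, ?_⟩⟩
    rw [zero_add, add_comm]

theorem IsBasisFor.finite_coker (hS : IsBasisFor h S) (hfin : S.Finite) : Finite (Coker h) := by
  have := hfin.to_subtype
  refine Finite.of_surjective (fun s : S => ((s : P) : Coker h)) ?_
  intro y
  induction y using AddCon.induction_on with | _ y
  obtain ⟨q, s, hs, rfl⟩ := hS.exists_rep y
  exact ⟨⟨s, hs⟩, (AddCon.eq _).2 ⟨h q, ⟨q, rfl⟩, 0, zero_mem _, by simp⟩⟩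

theorem exists_basis_of_bijective_sharpeningMap [IsCancelAdd P] [IsCancelAdd Q]
    (hinj : Function.Injective h) (hbar : Function.Bijective (sharpeningMap h))
    (hfin : Finite (Coker h)) :
    ∃ S : Set P, S.Finite ∧ (∀ s ∈ S, IsAddUnit s) ∧ IsBasisFor h S := by
  have huniq : ∀ (q q' : Q) (v v' : AddUnits P), h q + v = h q' + v' →
      ∃ u : AddUnits Q, q = u + q' := by
    intro q q' v v' e
    have : sharpeningMap h (q : Sharpening Q) = sharpeningMap h (q' : Sharpening Q) :=
      (AddCon.eq _).2 ⟨v, ⟨v, rfl⟩, v', ⟨v', rfl⟩, by simpa [add_comm] using e⟩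
    exact quotientCon_units_iff.1 ((AddCon.eq _).1 (hbar.1 this))
  refine exists_basis_of_units hinj ?_ ?_ huniq
  -- `P*/h(Q*)` embeds into `P/Q`: if `h q + v = h q' + v'`, then `q` and `q'` differ by a unit of
  -- `Q`, and cancelling `h q'` puts `v` and `v'` in one coset.
  · refine Finite.of_injective (β := Coker h)
      (Quotient.lift (fun v : AddUnits P => ((v : P) : Coker h)) ?_) ?_
    · intro v v' e
      obtain ⟨u, hu⟩ := QuotientAddGroup.leftRel_apply.1 e
      refine (AddCon.eq _).2 ⟨h u, ⟨u, rfl⟩, 0, zero_mem _, ?_⟩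
      have : AddUnits.map h u + v = v' := by rw [hu]; abel
      rw [← this, zero_add]; rfl
    · intro x y
      induction x using QuotientAddGroup.induction_on with | _ v
      induction y using QuotientAddGroup.induction_on with | _ v'
      intro e
      obtain ⟨_, ⟨q, rfl⟩, _, ⟨q', rfl⟩, e⟩ :=
        (AddCon.eq _).1 (show ((v : P) : Coker h) = ((v' : P) : Coker h) from e)
      obtain ⟨u, rfl⟩ := huniq _ _ _ _ e
      refine QuotientAddGroup.eq.2 ⟨u, ?_⟩
      have : AddUnits.map h u + v = v' := by
        ext
        refine add_left_cancel (a := h q') ?_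
        rw [← e, map_add, AddUnits.val_add, ← add_assoc, add_comm (h q')]; rfl
      rw [← this]; abel
  · intro p
    obtain ⟨x, hx⟩ := hbar.2 (p : Sharpening P)
    induction x using AddCon.induction_on with | _ q
    obtain ⟨v, hv⟩ := quotientCon_units_iff.1
      ((AddCon.eq _).1 (show ((p : P) : Sharpening P) = (h q : P) from hx.symm))
    exact ⟨q, v, by rw [hv, add_comm]⟩

theorem IsBasisFor.finite_quotient_units (hS : IsBasisFor h S) (hu : ∀ s ∈ S, IsAddUnit s)
    (hfin : S.Finite) : Finite (AddUnits P ⧸ (AddUnits.map h).range) := by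
  have := hfin.to_subtype
  refine Finite.of_surjective (fun s : S =>
    (QuotientAddGroup.mk (hu s s.2).addUnit : AddUnits P ⧸ (AddUnits.map h).range)) ?_
  intro y
  induction y using QuotientAddGroup.induction_on with | _ v
  obtain ⟨_, ⟨q, rfl⟩, s, hs, e⟩ := hS.exists_rep_unit ⟨v, rfl⟩
  refine ⟨⟨s, hs⟩, QuotientAddGroup.eq.2 ⟨q, ?_⟩⟩
  have : AddUnits.map h q + (hu s hs).addUnit = v := by ext; exact e
  rw [← this]; abel

/-! ### Pushouts -/

/-- The congruence on `Q × P*` whose quotient is the pushout of `Q` and `P*` over `Q*`. -/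
def unitCon (h : Q →+ P) : AddCon (Q × AddUnits P) where
  r x y := ∃ u : AddUnits Q, x.1 = u + y.1 ∧ AddUnits.map h u + x.2 = y.2
  iseqv :=
    { refl := fun _ => ⟨0, by simp, by simp⟩
      symm := by
        rintro x y ⟨u, e, e'⟩
        exact ⟨-u, by rw [e, ← add_assoc, AddUnits.neg_add, zero_add], by rw [← e']; simp⟩
      trans := by
        rintro x y z ⟨u, e, e'⟩ ⟨t, f, f'⟩
        exact ⟨u + t, by rw [e, f, ← add_assoc, AddUnits.val_add],
          by rw [← f', ← e', map_add]; abel⟩ }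
  add' := by
    rintro a b c d ⟨u, e, e'⟩ ⟨t, f, f'⟩
    refine ⟨u + t, ?_, ?_⟩
    · simp only [Prod.fst_add, e, f, AddUnits.val_add]; abel
    · simp only [Prod.snd_add, ← e', ← f', map_add]; abel

/-- The pushout is compared with the explicit model `(Q × P*)/Q*`. The map `d` to the model detects
when two sums `h q + v` agree, and `π ∘ d = id` shows that every element is such a sum. -/
theorem exists_basis_of_isPushout [IsCancelAdd P] [IsCancelAdd Q]
    (hinj : Function.Injective (AddUnits.map h))
    (hfin : Finite (AddUnits P ⧸ (AddUnits.map h).range))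
    (hpo : IsPushout (AddCommMonCat.ofHom (AddUnits.map h))
      (AddCommMonCat.ofHom (AddUnits.coeHom Q)) (AddCommMonCat.ofHom (AddUnits.coeHom P))
      (AddCommMonCat.ofHom h)) :
    ∃ S : Set P, S.Finite ∧ (∀ s ∈ S, IsAddUnit s) ∧ IsBasisFor h S := by
  let iQ : Q →+ (unitCon h).Quotient := (unitCon h).mk'.comp (AddMonoidHom.inl _ _)
  let iP : AddUnits P →+ (unitCon h).Quotient := (unitCon h).mk'.comp (AddMonoidHom.inr _ _)
  let π : (unitCon h).Quotient →+ P :=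
    (unitCon h).lift (AddMonoidHom.coprod h (AddUnits.coeHom P)) (by
      rintro ⟨q, v⟩ ⟨q', v'⟩ ⟨u, e, e'⟩
      dsimp only at e e'
      subst e e'
      change h (u + q') + (v : P) = h q' + ((AddUnits.map h u + v : AddUnits P) : P)
      rw [map_add, AddUnits.val_add, ← add_assoc, add_comm (h u)]; rfl)
  have w : AddCommMonCat.ofHom (AddUnits.map h) ≫ AddCommMonCat.ofHom iP =
      AddCommMonCat.ofHom (AddUnits.coeHom Q) ≫ AddCommMonCat.ofHom iQ := by
    ext u
    exact (AddCon.eq _).2 ⟨-u, (AddUnits.neg_add u).symm, by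
      rw [map_neg]; exact neg_add_cancel (AddUnits.map h u)⟩
  let d := hpo.desc _ _ w
  have d1 : ∀ v : AddUnits P, d.hom (v : P) = iP v := fun v =>
    congrArg (fun f => f.hom v) (hpo.inl_desc _ _ w)
  have d2 : ∀ q : Q, d.hom (h q) = iQ q := fun q =>
    congrArg (fun f => f.hom q) (hpo.inr_desc _ _ w)
  have d3 : d ≫ AddCommMonCat.ofHom π = 𝟙 (AddCommMonCat.of P) := by
    refine hpo.hom_ext ?_ ?_
    · ext v
      change π (d.hom (v : P)) = v
      rw [d1]
      change h 0 + (v : P) = v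
      simp
    · ext q
      change π (d.hom (h q)) = h q
      rw [d2]
      change h q + ((0 : AddUnits P) : P) = h q
      simp
  have huniq : ∀ (q q' : Q) (v v' : AddUnits P), h q + v = h q' + v' →
      ∃ u : AddUnits Q, q = u + q' ∧ AddUnits.map h u + v = v' := by
    intro q q' v v' e
    have e' := congrArg d.hom e
    rw [map_add, map_add, d1, d1, d2, d2] at e'
    have : (((q, v) : Q × AddUnits P) : (unitCon h).Quotient) = ((q', v') : Q × AddUnits P) := by
      have key : ∀ (q : Q) (v : AddUnits P),
          iQ q + iP v = (((q, v) : Q × AddUnits P) : (unitCon h).Quotient) := by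
        intro q v
        change ((((q, 0) : Q × AddUnits P) + (0, v) : Q × AddUnits P) : (unitCon h).Quotient) = _
        simp
      rw [← key, ← key, e']
    exact (AddCon.eq _).1 this
  refine exists_basis_of_units ?_ hfin ?_ fun q q' v v' e =>
    (huniq q q' v v' e).imp fun _ h => h.1
  · intro q q' e
    obtain ⟨u, rfl, hu⟩ := huniq q q' 0 0 (by rw [e])
    have : u = 0 := hinj (by simpa using hu)
    simp [this]
  · intro p
    have hp : π (d.hom p) = p := congrArg (fun f => f.hom p) d3
    generalize d.hom p = x at hp
    induction x using AddCon.induction_on with | _ x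
    exact ⟨x.1, x.2, hp⟩

/-- The universal property of the pushout of `Q` and `P*` over `Q*`, in terms of elements and for
targets in any universe. -/
theorem IsBasisFor.exists_lift {T : Type*} [AddCommMonoid T] (hS : IsBasisFor h S)
    (hu : ∀ s ∈ S, IsAddUnit s) (f : Q →+ T) (g : AddUnits P →+ T)
    (hfg : ∀ u : AddUnits Q, g (AddUnits.map h u) = f u) :
    ∃ Φ : P →+ T, (∀ q, Φ (h q) = f q) ∧ ∀ v : AddUnits P, Φ v = g v := by
  choose q s hs e using hS.exists_rep
  let φ : P → T := fun p => f (q p) + g (hu (s p) (hs p)).addUnit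
  -- The value of `φ` may be computed from any decomposition `h a + v`, not only the chosen one;
  -- additivity follows at once.
  have hφ : ∀ (a : Q) (v : AddUnits P), φ (h a + (v : P)) = f a + g v := by
    intro a v
    obtain ⟨_, ⟨b, rfl⟩, t, ht, e'⟩ := hS.exists_rep_unit ⟨v, rfl⟩
    have e1 : h (q (h a + v)) + s (h a + v) = h (a + b) + t := by
      rw [e, map_add, add_assoc, e']
    obtain ⟨e2, e3⟩ := hS.unique (hs _) ht e1
    have e4 : v = AddUnits.map h b + (hu (s (h a + v)) (hs _)).addUnit := by
      ext
      simpa [e3] using e'.symm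
    change f (q (h a + v)) + _ = _
    conv_rhs => rw [e4]
    rw [e2, map_add, map_add, hfg, add_assoc]
  have hφ' : ∀ p, ∃ (a : Q) (v : AddUnits P), h a + (v : P) = p := fun p =>
    ⟨q p, (hu (s p) (hs p)).addUnit, e p⟩
  refine ⟨{ toFun := φ, map_zero' := by simpa using hφ 0 0, map_add' := ?_ }, fun q => ?_,
    fun v => ?_⟩
  · intro x y
    obtain ⟨a, v, rfl⟩ := hφ' x
    obtain ⟨b, v', rfl⟩ := hφ' y
    have : h a + (v : P) + (h b + (v' : P)) = h (a + b) + ((v + v' : AddUnits P) : P) := by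
      rw [map_add, AddUnits.val_add]; abel
    rw [this, hφ, hφ, hφ, map_add, map_add]; abel
  · simpa using hφ q 0
  · simpa using hφ 0 v

theorem IsBasisFor.isPushout (hS : IsBasisFor h S) (hu : ∀ s ∈ S, IsAddUnit s) :
    IsPushout (AddCommMonCat.ofHom (AddUnits.map h))
      (AddCommMonCat.ofHom (AddUnits.coeHom Q)) (AddCommMonCat.ofHom (AddUnits.coeHom P))
      (AddCommMonCat.ofHom h) := by
  refine ⟨⟨by ext; rfl⟩, ⟨Limits.PushoutCocone.isColimitAux' _ fun c => ?_⟩⟩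
  have hc : ∀ u : AddUnits Q, c.inl.hom (AddUnits.map h u) = c.inr.hom (u : Q) := fun u =>
    congrArg (fun f => f.hom u) c.condition
  let Φ := (hS.exists_lift hu c.inr.hom c.inl.hom hc).choose
  have hΦ : (∀ q, Φ (h q) = c.inr.hom q) ∧ ∀ v : AddUnits P, Φ v = c.inl.hom v :=
    (hS.exists_lift hu c.inr.hom c.inl.hom hc).choose_spec
  refine ⟨AddCommMonCat.ofHom Φ, ?_, ?_, ?_⟩
  · ext v
    exact hΦ.2 v
  · ext a
    exact hΦ.1 a
  · intro m hm hm'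
    ext p
    obtain ⟨a, s, hs, rfl⟩ := hS.exists_rep p
    obtain ⟨v, rfl⟩ := hu s hs
    have e1 : m.hom (v : P) = c.inl.hom v := congrArg (fun f => f.hom v) hm
    have e2 : m.hom (h a) = c.inr.hom a := congrArg (fun f => f.hom a) hm'
    calc m.hom (h a + (v : P)) = m.hom (h a) + m.hom (v : P) := map_add m.hom _ _
      _ = Φ (h a) + Φ (v : P) := by rw [e1, e2, hΦ.1, hΦ.2]
      _ = Φ (h a + (v : P)) := (map_add Φ _ _).symm

/-! ### Spectra -/

theorem Spec.mem_of_isAddUnit {P : Type u} [AddCommMonoid P] (F : Spec P) {v : P}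
    (hv : IsAddUnit v) : v ∈ F.face := by
  obtain ⟨w, hw⟩ := hv.exists_neg
  exact (F.mem_of_add_mem v w (hw ▸ F.face.zero_mem)).1

theorem Spec.add_unit_mem_iff {P : Type u} [AddCommMonoid P] (F : Spec P) {p v : P}
    (hv : IsAddUnit v) : p + v ∈ F.face ↔ p ∈ F.face :=
  ⟨fun hp => (F.mem_of_add_mem p v hp).1, fun hp => F.face.add_mem hp (F.mem_of_isAddUnit hv)⟩

/-- Adding a unit does not affect membership in a face, so `h q + s` and `h q` define the same basic
open set. Thus the basic opens of `Spec P` are the preimages of those of `Spec Q`, and faces are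
determined by their preimages. -/
theorem IsBasisFor.isHomeomorph_specMap (hS : IsBasisFor h S) (hu : ∀ s ∈ S, IsAddUnit s) :
    IsHomeomorph (specMap h) := by
  have hmem : ∀ (F : Spec P) (q : Q), q ∈ (specMap h F).face ↔ h q ∈ F.face := fun F q => Iff.rfl
  have hind : Topology.IsInducing (specMap h) := by
    refine ⟨?_⟩
    change TopologicalSpace.generateFrom _ =
      TopologicalSpace.induced _ (TopologicalSpace.generateFrom _)
    rw [induced_generateFrom_eq]
    congr 1
    ext U
    constructor
    · rintro ⟨p, rfl⟩
      obtain ⟨q, s, hs, rfl⟩ := hS.exists_rep p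
      refine ⟨_, ⟨q, rfl⟩, ?_⟩
      ext F
      exact (F.add_unit_mem_iff (hu s hs)).symm
    · rintro ⟨_, ⟨q, rfl⟩, rfl⟩
      exact ⟨h q, rfl⟩
  have hinj : Function.Injective (specMap h) := by
    intro F G e
    ext p
    obtain ⟨q, s, hs, rfl⟩ := hS.exists_rep p
    rw [F.add_unit_mem_iff (hu s hs), G.add_unit_mem_iff (hu s hs), ← hmem, ← hmem, e]
  have hsurj : Function.Surjective (specMap h) := by
    intro G
    have key : ∀ {q q' : Q} {v v' : P}, IsAddUnit v → IsAddUnit v' → h q + v = h q' + v' →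
        q' ∈ G.face → q ∈ G.face := by
      intro q q' v v' hv hv' e hq
      obtain ⟨u, hu, rfl⟩ := hS.exists_unit hv hv' e
      exact G.face.add_mem (G.mem_of_isAddUnit hu) hq
    -- The face over `G` is `h(G) + P*`; `key` shows that membership does not depend on the
    -- decomposition.
    refine ⟨⟨⟨⟨{p | ∃ q ∈ G.face, ∃ v, IsAddUnit v ∧ h q + v = p}, ?_⟩, ?_⟩, ?_⟩, ?_⟩
    · rintro _ _ ⟨q, hq, v, hv, rfl⟩ ⟨q', hq', v', hv', rfl⟩
      exact ⟨q + q', G.face.add_mem hq hq', v + v', hv.add hv', by rw [map_add]; abel⟩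
    · exact ⟨0, G.face.zero_mem, 0, isAddUnit_zero, by simp⟩
    · rintro p p' ⟨q, hq, v, hv, e⟩
      obtain ⟨a, s, hs, rfl⟩ := hS.exists_rep p
      obtain ⟨b, t, ht, rfl⟩ := hS.exists_rep p'
      have : a + b ∈ G.face := key ((hu s hs).add (hu t ht)) hv
        (by rw [e, map_add]; abel : h (a + b) + (s + t) = h q + v) hq
      obtain ⟨ha, hb⟩ := G.mem_of_add_mem _ _ this
      exact ⟨⟨a, ha, s, hu s hs, rfl⟩, ⟨b, hb, t, hu t ht, rfl⟩⟩
    · ext q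
      constructor
      · rintro ⟨a, ha, v, hv, e⟩
        exact key isAddUnit_zero hv (by rw [e, add_zero]) ha
      · intro hq
        exact ⟨q, hq, 0, isAddUnit_zero, add_zero _⟩
  exact isHomeomorph_iff_isEmbedding_surjective.2 ⟨⟨hind, hinj⟩, hsurj⟩

end Hom

/-! ### Flat modules -/

section Mod

variable {Q : Type u} [AddCommMonoid Q]

/-- The two elements are multiples of the same basis element `t`, since uniqueness of coordinates
matches their basis elements. The last clause is what later yields injectivity of flat maps. -/
theorem ModFree.exists_of_smul_eq {M : Mod Q} (hM : ModFree M) {x y : M.V} {q q' : Q}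
    (e : M.ρ (Multiplicative.ofAdd q) x = M.ρ (Multiplicative.ofAdd q') y) :
    ∃ r r' : Q, ∃ t : M.V, M.ρ (Multiplicative.ofAdd r) t = x ∧
      M.ρ (Multiplicative.ofAdd r') t = y ∧ q + r = q' + r' ∧ (x = y → r = r') := by
  obtain ⟨S, hS⟩ := hM
  obtain ⟨⟨r, s⟩, rfl⟩ := hS.2 x
  obtain ⟨⟨r', s'⟩, rfl⟩ := hS.2 y
  have key : ∀ (a b : Q) (m : M.V), M.ρ (Multiplicative.ofAdd a) (M.ρ (Multiplicative.ofAdd b) m) =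
      M.ρ (Multiplicative.ofAdd (a + b)) m := fun a b m =>
    (congrArg (fun f => f m) (M.ρ.map_mul (Multiplicative.ofAdd a) (Multiplicative.ofAdd b))).symm
  dsimp only at e ⊢
  rw [key, key] at e
  have h1 := @hS.1 (q + r, s) (q' + r', s') e
  obtain rfl : s = s' := congrArg Prod.snd h1
  refine ⟨r, r', s, rfl, rfl, congrArg Prod.fst h1, fun h2 => ?_⟩
  exact congrArg Prod.fst (@hS.1 (r, s) (r', s) h2)

/-- An equation in a filtered colimit already holds at some stage, and there the module is free. -/
theorem ModFlat.exists_of_smul_eq {M : Mod Q} (hM : ModFlat M) {x y : M.V} {q q' : Q}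
    (e : M.ρ (Multiplicative.ofAdd q) x = M.ρ (Multiplicative.ofAdd q') y) :
    ∃ r r' : Q, ∃ t : M.V, M.ρ (Multiplicative.ofAdd r) t = x ∧
      M.ρ (Multiplicative.ofAdd r') t = y ∧ q + r = q' + r' ∧ (x = y → r = r') := by
  obtain ⟨J, _, _, ⟨F, ι, hc⟩, hfree⟩ := hM
  have hc' := Limits.isColimitOfPreserves (Action.forget (Type u) (Multiplicative Q)) hc
  have hι : ∀ (j : J) (a : Q) (m : (F.obj j).V), (ι.app j).hom ((F.obj j).ρ (Multiplicative.ofAdd a) m) =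
      M.ρ (Multiplicative.ofAdd a) ((ι.app j).hom m) := fun j a m =>
    congrArg (fun f => f m) ((ι.app j).comm (Multiplicative.ofAdd a))
  have hF : ∀ {i j : J} (f : i ⟶ j) (a : Q) (m : (F.obj i).V),
      (F.map f).hom ((F.obj i).ρ (Multiplicative.ofAdd a) m) =
      (F.obj j).ρ (Multiplicative.ofAdd a) ((F.map f).hom m) := fun f a m =>
    congrArg (fun f => f m) ((F.map f).comm (Multiplicative.ofAdd a))
  have hw : ∀ {i j : J} (f : i ⟶ j) (m : (F.obj i).V),
      (ι.app j).hom ((F.map f).hom m) = (ι.app i).hom m := fun {i j} f m => 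
    congrArg (fun g : F.obj i ⟶ M => g.hom m) ((ι.naturality f).trans (Category.comp_id _))
  -- a common stage for `x` and `y`, with a single representative if they are equal
  have hstage : ∃ (i : J) (a b : (F.obj i).V), (ι.app i).hom a = x ∧ (ι.app i).hom b = y ∧
      (x = y → a = b) := by
    obtain ⟨i, a, ha⟩ := Limits.Types.jointly_surjective _ hc' x
    by_cases hxy : x = y
    · exact ⟨i, a, a, ha, ha.trans hxy, fun _ => rfl⟩
    · obtain ⟨j, b, hb⟩ := Limits.Types.jointly_surjective _ hc' y
      refine ⟨IsFiltered.max i j, (F.map (IsFiltered.leftToMax i j)).hom a,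
        (F.map (IsFiltered.rightToMax i j)).hom b, (hw (IsFiltered.leftToMax i j) a).trans ha,
        (hw (IsFiltered.rightToMax i j) b).trans hb,
        fun h => absurd h hxy⟩
  obtain ⟨i, a, b, rfl, rfl, hab⟩ := hstage
  rw [← hι, ← hι] at e
  obtain ⟨k, f, g, hfg⟩ := (Limits.Types.FilteredColimit.isColimit_eq_iff _ hc').1 e
  have hfg : (F.map f).hom ((F.obj i).ρ (Multiplicative.ofAdd q) a) =
    (F.map g).hom ((F.obj i).ρ (Multiplicative.ofAdd q') b) := hfg
  -- Coequalizing `f` and `g` moves `a` and `b` along one and the same map, so `a = b` still gives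
  -- equal images; the last clause needs this.
  have hfg' : (F.obj (IsFiltered.coeq f g)).ρ (Multiplicative.ofAdd q)
        ((F.map (f ≫ IsFiltered.coeqHom f g)).hom a) =
      (F.obj (IsFiltered.coeq f g)).ρ (Multiplicative.ofAdd q')
        ((F.map (f ≫ IsFiltered.coeqHom f g)).hom b) := by
    rw [← hF, ← hF]
    conv_rhs => rw [IsFiltered.coeq_condition f g]
    rw [F.map_comp, F.map_comp]
    exact congrArg (F.map (IsFiltered.coeqHom f g)).hom hfg
  obtain ⟨r, r', t, h1, h2, h3, h4⟩ := ModFree.exists_of_smul_eq (hfree _) hfg'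
  refine ⟨r, r', (ι.app _).hom t, ?_, ?_, h3, fun h => h4 (by rw [hab h])⟩
  · rw [← hι, h1, hw]
  · rw [← hι, h2, hw]

end Mod

section Hom

variable {Q P : Type u} [AddCommMonoid Q] [AddCommMonoid P] {h : Q →+ P} {S : Set P}

/-- The equational form of flatness of a map of monoids. -/
def IsEquationallyFlat (h : Q →+ P) : Prop :=
  ∀ (q q' : Q) (p p' : P), h q + p = h q' + p' →
    ∃ r r' t, p = h r + t ∧ p' = h r' + t ∧ q + r = q' + r'

theorem IsFlatHom.isEquationallyFlat (hh : IsFlatHom h) : IsEquationallyFlat h := by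
  intro q q' p p' e
  obtain ⟨r, r', t, h1, h2, h3, -⟩ :=
    ModFlat.exists_of_smul_eq (M := asModule h) hh (x := p) (y := p') e
  exact ⟨r, r', t, h1.symm, h2.symm, h3⟩

/-- Apply the criterion to `x = y = 0`: then `r = r'`, and it cancels from `q + r = q' + r'`. -/
theorem IsFlatHom.injective [IsCancelAdd Q] (hh : IsFlatHom h) : Function.Injective h := by
  intro q q' e
  obtain ⟨r, r', t, h1, h2, h3, h4⟩ :=
    ModFlat.exists_of_smul_eq (M := asModule h) hh (x := (0 : P)) (y := (0 : P))
    (congrArg (· + (0 : P)) e : h q + 0 = h q' + 0)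
  obtain rfl := h4 rfl
  exact add_right_cancel h3

/-! ### Finite maps -/

theorem isFiniteHom_iff : IsFiniteHom h ↔
    ∃ S : Finset P, ∀ p, ∃ q, ∃ s ∈ S, h q + s = p := by
  classical
  constructor
  · rintro ⟨S, hfin, hS⟩
    refine ⟨hfin.toFinset, fun p => ?_⟩
    obtain ⟨⟨q, s⟩, e⟩ := hS p
    exact ⟨q, s.1, hfin.mem_toFinset.2 s.2, e⟩
  · rintro ⟨S, hS⟩
    refine ⟨(S : Set P), S.finite_toSet, fun p => ?_⟩
    obtain ⟨q, s, hs, e⟩ := hS p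
    exact ⟨(q, ⟨s, hs⟩), e⟩

/-- Modulo the action of `Q`, adding `p` induces a self-map `g` of the finite generating set. A
repetition in a `g`-orbit gives `(n - m) • p + t = h b + t`, and `t` cancels. -/
theorem IsFiniteHom.exists_nsmul_eq [IsCancelAdd P] (hh : IsFiniteHom h) (p : P) :
    ∃ n : ℕ, 0 < n ∧ ∃ q, n • p = h q := by
  obtain ⟨S, hS⟩ := isFiniteHom_iff.1 hh
  obtain ⟨_, s₀, hs₀, -⟩ := hS 0
  choose a f hf e using fun s : S => hS (p + s)
  let g : S → S := fun s => ⟨f s, hf s⟩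
  have hiter : ∀ (n : ℕ) (s : S), ∃ b, n • p + s = h b + (g^[n] s : S) := by
    intro n s
    induction n with
    | zero => exact ⟨0, by simp⟩
    | succ n ih =>
      obtain ⟨b, hb⟩ := ih
      refine ⟨a (g^[n] s) + b, ?_⟩
      rw [Function.iterate_succ_apply', succ_nsmul', add_assoc, hb, add_left_comm, ← e, map_add,
        add_left_comm, add_assoc]
  obtain ⟨m, n, hmn, hs⟩ :=
    Finite.exists_ne_map_eq_of_infinite (fun n : ℕ => g^[n] ⟨s₀, hs₀⟩)
  wlog hlt : m < n generalizing m n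
  · exact this n m hmn.symm hs.symm (lt_of_le_of_ne (not_lt.1 hlt) hmn.symm)
  obtain ⟨b, hb⟩ := hiter (n - m) (g^[m] ⟨s₀, hs₀⟩)
  have hs : g^[m] ⟨s₀, hs₀⟩ = g^[n] ⟨s₀, hs₀⟩ := hs
  rw [← Function.iterate_add_apply, Nat.sub_add_cancel hlt.le, ← hs] at hb
  exact ⟨n - m, Nat.sub_pos_of_lt hlt, b, add_right_cancel hb⟩

/-- If only `0` maps to `0`, a finite map is local. -/
theorem IsFiniteHom.isLocalMap [IsCancelAdd P] (hh : IsFiniteHom h)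
    (h0 : ∀ q, h q = 0 → IsAddUnit q) : IsLocalMap h := by
  refine fun q => ⟨fun hq => ?_, fun hq => hq.map h⟩
  obtain ⟨p, hp⟩ := hq.exists_neg
  obtain ⟨n, hn, z, hz⟩ := hh.exists_nsmul_eq p
  have h1 : h (n • q + z) = 0 := by
    rw [map_add, map_nsmul, ← hz, ← nsmul_add, hp, nsmul_zero]
  obtain ⟨m, rfl⟩ := Nat.exists_eq_add_of_lt hn
  rw [zero_add, succ_nsmul', add_assoc] at h1
  exact isAddUnit_of_add (h0 _ h1)

/-- Finite flat maps are free on a finite basis. -/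
theorem IsEquationallyFlat.exists_isBasisFor [IsCancelAdd P] (hflat : IsEquationallyFlat h)
    (hinj : Function.Injective h) (hh : IsFiniteHom h) :
    ∃ S : Set P, S.Finite ∧ IsBasisFor h S := by
  classical
  obtain ⟨S, hS⟩ := exists_minimal_of_wellFoundedLT _ (isFiniteHom_iff.1 hh)
  -- By minimality, no generator is a translate of a different one.
  have hred : ∀ (r : Q), ∀ s ∈ S, ∀ s' ∈ S, s = h r + s' → s = s' := by
    intro r s hs s' hs' e
    by_contra hne
    have hgen : ∀ p, ∃ q, ∃ t ∈ S.erase s, h q + t = p := by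
      intro p
      obtain ⟨q, t, ht, rfl⟩ := hS.prop p
      by_cases hts : t = s
      · refine ⟨q + r, s', Finset.mem_erase.2 ⟨fun h => hne h.symm, hs'⟩, ?_⟩
        rw [hts, e, map_add, add_assoc]
      · exact ⟨q, t, Finset.mem_erase.2 ⟨hts, ht⟩, rfl⟩
    exact Finset.notMem_erase s S (hS.le_of_le hgen (Finset.erase_subset _ _) hs)
  refine ⟨S, S.finite_toSet, isBasisFor_of_exists_rep hS.prop ?_⟩
  intro q q' s hs s' hs' e
  obtain ⟨r, r', t, h1, h2, -⟩ := hflat q q' s s' e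
  -- Expanding `t` makes both `s` and `s'` translates of the single generator `s''`, so both equal
  -- it.
  obtain ⟨r'', s'', hs'', rfl⟩ := hS.prop t
  rw [← add_assoc, ← map_add] at h1 h2
  obtain rfl : s = s' := (hred _ _ hs _ hs'' h1).trans (hred _ _ hs' _ hs'' h2).symm
  exact ⟨hinj (add_right_cancel e), rfl⟩

theorem exists_basis_of_isReducedHom [IsCancelAdd P] [IsCancelAdd Q] (hfin : IsFiniteHom h)
    (hflat : IsFlatHom h) (hred : IsReducedHom h) :
    ∃ S : Set P, S.Finite ∧ (∀ s ∈ S, IsAddUnit s) ∧ IsBasisFor h S := by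
  obtain ⟨S, hSfin, hS⟩ := hflat.isEquationallyFlat.exists_isBasisFor hflat.injective hfin
  refine ⟨S, hSfin, fun s hs => ?_, hS⟩
  obtain ⟨n, hn, q, hq⟩ := hfin.exists_nsmul_eq s
  by_contra hsu
  have hqu : ¬ IsAddUnit q := by
    intro hqu
    obtain ⟨m, rfl⟩ := Nat.exists_eq_add_of_lt hn
    rw [zero_add, succ_nsmul'] at hq
    exact hsu (isAddUnit_of_add (hq ▸ hqu.map h))
  -- Saturation puts `s` in the nonunit ideal; expanding `p'` over the basis then forces `a + b =
  -- 0`, although `a` is a nonunit.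
  obtain ⟨a, ha, p', e⟩ := hred n s hn ⟨q, hqu, 0, by rw [hq, add_zero]⟩
  obtain ⟨b, s', hs', rfl⟩ := hS.exists_rep p'
  have := (hS.unique hs hs' (by rw [map_zero, zero_add, e, map_add, add_assoc] :
    h 0 + s = h (a + b) + s')).1
  exact ha (isAddUnit_of_add (this ▸ isAddUnit_zero))

end Hom

/-! ### From properties of `k[h]` to properties of `h` -/

/-- The fibres of a finite type unramified algebra are reduced. -/
theorem isReduced_quotient_map {A B : Type*} [CommRing A] [CommRing B] [Algebra A B]
    [Algebra.FormallyUnramified A B] [Algebra.FiniteType A B] (J : Ideal A) [J.IsMaximal] :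
    IsReduced (B ⧸ J.map (algebraMap A B)) := by
  let : Field (A ⧸ J) := Ideal.Quotient.field J
  have : Algebra.FormallyUnramified A (B ⧸ J.map (algebraMap A B)) :=
    .of_surjective (Ideal.Quotient.mkₐ A _) (Ideal.Quotient.mkₐ_surjective A _)
  have : Algebra.FiniteType A (B ⧸ J.map (algebraMap A B)) :=
    .of_surjective (Ideal.Quotient.mkₐ A _) (Ideal.Quotient.mkₐ_surjective A _)
  have : Algebra.FormallyUnramified (A ⧸ J) (B ⧸ J.map (algebraMap A B)) :=
    .of_restrictScalars A _ _
  have : Algebra.FiniteType (A ⧸ J) (B ⧸ J.map (algebraMap A B)) :=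
    .of_restrictScalars_finiteType A _ _
  exact Algebra.FormallyUnramified.isReduced_of_field (A ⧸ J) _

section Algebra

variable {Q P : Type u} [AddCommMonoid Q] [AddCommMonoid P] {h : Q →+ P} {S : Set P}
  {k : Type v} [Field k]

theorem algMap_single (q : Q) (c : k) :
    algMap k h (AddMonoidAlgebra.single q c) = AddMonoidAlgebra.single (h q) c := by
  rw [algMap, AddMonoidAlgebra.mapDomainRingHom_apply, AddMonoidAlgebra.mapDomain_single]

theorem exists_of_mem_support_algMap_mul {a : AddMonoidAlgebra k Q} {x : AddMonoidAlgebra k P}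
    {p : P} (hp : p ∈ (algMap k h a * x).coeff.support) :
    ∃ q ∈ a.coeff.support, ∃ t ∈ x.coeff.support, h q + t = p := by
  classical
  obtain ⟨b, hb, t, ht, rfl⟩ := Finset.mem_add.1 (AddMonoidAlgebra.support_coeff_mul_subset _ _ hp)
  rw [algMap, AddMonoidAlgebra.mapDomainRingHom_apply, AddMonoidAlgebra.coeff_mapDomain] at hb
  obtain ⟨q, hq, rfl⟩ := Finset.mem_image.1 (Finsupp.mapDomain_support hb)
  exact ⟨q, hq, t, ht, rfl⟩

/-- The exponents occurring in a finite generating set of `k[P]` over `k[Q]` generate `P` over `Q`.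
-/
theorem isFiniteHom_of_finite_algMap (hfin : (algMap k h).Finite) : IsFiniteHom h := by
  classical
  algebraize [algMap k h]
  obtain ⟨T, hT⟩ := (Module.finite_def.1 ‹Module.Finite (AddMonoidAlgebra k Q)
    (AddMonoidAlgebra k P)›)
  refine isFiniteHom_iff.2 ⟨T.biUnion fun x => x.coeff.support, fun p => ?_⟩
  have key : ∀ x ∈ Submodule.span (AddMonoidAlgebra k Q) (T : Set (AddMonoidAlgebra k P)),
      ∀ p ∈ x.coeff.support, ∃ q, ∃ s ∈ T.biUnion fun x => x.coeff.support, h q + s = p := by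
    intro x hx
    induction hx using Submodule.span_induction with
    | mem x hx =>
      exact fun p hp => ⟨0, p, Finset.mem_biUnion.2 ⟨x, hx, hp⟩, by simp⟩
    | zero => simp
    | add x y _ _ hx hy =>
      intro p hp
      rw [AddMonoidAlgebra.coeff_add] at hp
      rcases Finset.mem_union.1 (Finsupp.support_add hp) with hp | hp
      · exact hx p hp
      · exact hy p hp
    | smul a x _ hx =>
      intro p hp
      obtain ⟨q, -, t, ht, rfl⟩ := exists_of_mem_support_algMap_mul (h := h) hp
      obtain ⟨q', s, hs, rfl⟩ := hx t ht
      exact ⟨q + q', s, hs, by rw [map_add, add_assoc]⟩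
  refine key (AddMonoidAlgebra.single p 1) (hT ▸ Submodule.mem_top) p ?_
  simp

/-- A monomial in a linear combination of elements of `k[P]` with coefficients in `k[Q]` comes
from a monomial in one of the coefficients. -/
theorem exists_of_single_eq_sum {n : ℕ} {a : Fin n → AddMonoidAlgebra k Q}
    {y : Fin n → AddMonoidAlgebra k P} {p : P}
    (e : AddMonoidAlgebra.single p 1 = ∑ j, algMap k h (a j) * y j) :
    ∃ j, ∃ r ∈ (a j).coeff.support, ∃ t, h r + t = p := by
  have h1 : p ∈ (∑ j, algMap k h (a j) * y j).coeff.support := by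
    rw [← e]; simp
  rw [AddMonoidAlgebra.coeff_sum, Finsupp.mem_support_iff, Finsupp.finsetSum_apply] at h1
  obtain ⟨j, -, hj⟩ := Finset.exists_ne_zero_of_sum_ne_zero h1
  obtain ⟨r, hr, t, -, e⟩ := exists_of_mem_support_algMap_mul (Finsupp.mem_support_iff.2 hj)
  exact ⟨j, r, hr, t, e⟩

theorem exists_of_single_mul_eq [IsCancelAdd Q] {q q' : Q} {a a' : AddMonoidAlgebra k Q}
    (e : AddMonoidAlgebra.single q 1 * a = AddMonoidAlgebra.single q' 1 * a') {r : Q}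
    (hr : r ∈ a.coeff.support) : ∃ r' ∈ a'.coeff.support, q + r = q' + r' := by
  have h1 : q + r ∈ (AddMonoidAlgebra.single q (1 : k) * a).coeff.support := by
    rw [AddMonoidAlgebra.support_coeff_single_mul _ _ (by simp)]
    exact Finset.mem_map.2 ⟨r, hr, rfl⟩
  rw [e, AddMonoidAlgebra.support_coeff_single_mul _ _ (by simp)] at h1
  obtain ⟨r', hr', e⟩ := Finset.mem_map.1 h1
  exact ⟨r', hr', e.symm⟩

/-- The equational criterion for flatness is applied to the binomial relation attached to `h q + p =
h q' + p'`. The monomial of `p` must occur in some term, which supplies `r` and `t`, and the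
relation between coefficients supplies `r'`. -/
theorem isEquationallyFlat_of_flat_algMap [IsCancelAdd Q] [IsCancelAdd P]
    (hflat : (algMap k h).Flat) : IsEquationallyFlat h := by
  intro q q' p p' e
  algebraize [algMap k h]
  have hrel : ∑ i, (![AddMonoidAlgebra.single q 1, -AddMonoidAlgebra.single q' 1] :
      Fin 2 → AddMonoidAlgebra k Q) i • (![AddMonoidAlgebra.single p 1,
        AddMonoidAlgebra.single p' 1] : Fin 2 → AddMonoidAlgebra k P) i = 0 := by
    simp [Fin.sum_univ_two, Algebra.smul_def, RingHom.algebraMap_toAlgebra, algMap_single,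
      AddMonoidAlgebra.single_mul_single, e]
  obtain ⟨n, a, y, hy, ha⟩ := Module.Flat.iff_forall_isTrivialRelation.1
    ‹Module.Flat (AddMonoidAlgebra k Q) (AddMonoidAlgebra k P)› hrel
  obtain ⟨j, r, hr, t, hrt⟩ := exists_of_single_eq_sum (h := h) (hy 0)
  have ha := ha j
  rw [Fin.sum_univ_two] at ha
  simp only [Matrix.cons_val_zero, Matrix.cons_val_one, neg_mul, add_neg_eq_zero] at ha
  obtain ⟨r', -, hr'⟩ := exists_of_single_mul_eq ha hr
  refine ⟨r, r', t, hrt.symm, ?_, hr'⟩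
  -- The formula for `p'` comes from cancellation; the expansion of its monomial might involve
  -- another `t`.
  refine add_left_cancel (a := h q') ?_
  rw [← e, ← add_assoc, ← map_add, ← hr', map_add, add_assoc, hrt]

/-- Flatness applied to the relation that the difference of the monomials of `q` and `q'` kills `1`
gives `a` annihilated by this difference, with an exponent `r` whose image is a unit. -/
theorem exists_of_flat_algMap (hflat : (algMap k h).Flat) {q q' : Q} (e : h q = h q') :
    ∃ a : AddMonoidAlgebra k Q, ∃ r ∈ a.coeff.support, ∃ t, h r + t = 0 ∧
      AddMonoidAlgebra.single q 1 * a = AddMonoidAlgebra.single q' 1 * a := by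
  algebraize [algMap k h]
  have hrel : ∑ i, (![AddMonoidAlgebra.single q 1 - AddMonoidAlgebra.single q' 1] :
      Fin 1 → AddMonoidAlgebra k Q) i • (![AddMonoidAlgebra.single 0 1] :
        Fin 1 → AddMonoidAlgebra k P) i = 0 := by
    simp [Algebra.smul_def, RingHom.algebraMap_toAlgebra, algMap_single, e]
  obtain ⟨n, a, y, hy, ha⟩ := Module.Flat.iff_forall_isTrivialRelation.1
    ‹Module.Flat (AddMonoidAlgebra k Q) (AddMonoidAlgebra k P)› hrel
  obtain ⟨j, r, hr, t, hrt⟩ := exists_of_single_eq_sum (h := h) (hy 0)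
  refine ⟨a 0 j, r, hr, t, hrt, ?_⟩
  simpa [sub_mul, sub_eq_zero] using ha j

theorem injective_of_flat_algMap [IsCancelAdd Q] [IsCancelAdd P] (hfin : IsFiniteHom h)
    (hflat : (algMap k h).Flat) (hu : Function.Injective (AddUnits.map h)) :
    Function.Injective h := by
  have hu' : ∀ u : Q, IsAddUnit u → h u = 0 → u = 0 := by
    rintro _ ⟨u, rfl⟩ e
    have : u = 0 := hu (by ext; simpa using e)
    rw [this, AddUnits.val_zero]
  have h0 : ∀ q, h q = 0 → IsAddUnit q := by
    intro q e
    obtain ⟨a, r, hr, t, -, ha⟩ := exists_of_flat_algMap hflat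
      (show h q = h 0 by rw [e, map_zero])
    -- The monomial of `q` fixes `a`, so the finite support of `a` is stable under adding `q`. A
    -- repetition makes a positive multiple of `q` vanish.
    have hn : ∀ n : ℕ, n • q + r ∈ a.coeff.support := by
      intro n
      induction n with
      | zero => simpa using hr
      | succ n ih =>
        obtain ⟨r', hr', e⟩ := exists_of_single_mul_eq ha ih
        rwa [succ_nsmul', add_assoc, e, zero_add]
    obtain ⟨m, n, hmn, e⟩ := Finite.exists_ne_map_eq_of_infinite
      (fun n : ℕ => (⟨n • q + r, hn n⟩ : a.coeff.support))
    wlog hlt : m < n generalizing m n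
    · exact this n m hmn.symm e.symm (lt_of_le_of_ne (not_lt.1 hlt) hmn.symm)
    have e1 : m • q = n • q := add_right_cancel (Subtype.ext_iff.1 e)
    obtain ⟨d, rfl⟩ := Nat.exists_eq_add_of_lt hlt
    rw [add_assoc, add_nsmul, left_eq_add, succ_nsmul'] at e1
    exact isAddUnit_of_add (e1 ▸ isAddUnit_zero)
  have hloc := hfin.isLocalMap h0
  intro q q' e
  obtain ⟨a, r, hr, t, hrt, ha⟩ := exists_of_flat_algMap hflat e
  -- By locality `r` and `r'` are units, and they have the same image, so injectivity on units gives
  -- `r = r'`, which cancels.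
  obtain ⟨r', hr', e1⟩ := exists_of_single_mul_eq ha hr
  have hrr : h r = h r' := by
    have := congrArg h e1
    rw [map_add, map_add, e] at this
    exact add_left_cancel this
  have hru : IsAddUnit r := (hloc r).1 (isAddUnit_of_add (hrt ▸ isAddUnit_zero))
  have hru' : IsAddUnit r' := (hloc r').1 (isAddUnit_of_add (hrr ▸ hrt ▸ isAddUnit_zero))
  have : r = r' := by
    obtain ⟨w, hw⟩ := hru'.exists_neg
    have h2 : r + w = 0 := hu' _ (hru.add ⟨⟨w, r', by rw [add_comm, hw], hw⟩, rfl⟩)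
      (by rw [map_add, hrr, ← map_add, hw, map_zero])
    exact add_right_cancel (h2.trans hw.symm)
  subst this
  exact add_right_cancel e1

/-- The augmentation of `k[Q]` which sends units of `Q` to one and nonunits to zero. -/
noncomputable def unitAugmentation (k : Type v) [Field k] (Q : Type u) [AddCommMonoid Q] :
    AddMonoidAlgebra k Q →ₐ[k] k :=
  open Classical in
  AddMonoidAlgebra.lift k k Q
    { toFun := fun q => if IsAddUnit q.toAdd then 1 else 0
      map_one' := if_pos isAddUnit_zero
      map_mul' := fun a b => by
        simp only [toAdd_mul, IsAddUnit.add_iff]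
        split_ifs <;> simp_all }

open Classical in
theorem unitAugmentation_single (q : Q) (c : k) :
    unitAugmentation k Q (AddMonoidAlgebra.single q c) = if IsAddUnit q then c else 0 := by
  rw [unitAugmentation, AddMonoidAlgebra.lift_single]
  change c • (if IsAddUnit q then (1 : k) else 0) = _
  split_ifs <;> simp

/-- An element of a basis does not lie in the ideal of `k[P]` generated by the kernel of the
augmentation of `k[Q]`. -/
theorem IsBasisFor.single_notMem_map_ker (hS : IsBasisFor h S) {s₀ : P} (hs₀ : s₀ ∈ S) :
    AddMonoidAlgebra.single s₀ (1 : k) ∉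
      (RingHom.ker (unitAugmentation k Q)).map (algMap k h) := by
  classical
  choose q s hs e using hS.exists_rep
  have hqs : ∀ (a : Q) (p : P), q (h a + p) = a + q p ∧ s (h a + p) = s p := fun a p =>
    hS.unique (hs _) (hs _) (by rw [e, map_add, add_assoc, e])
  have hs₀' : q s₀ = 0 ∧ s s₀ = s₀ := hS.unique (hs _) hs₀ (by rw [e, map_zero, zero_add])
  let ε := unitAugmentation k Q
  -- `L` is the `s₀`-coordinate of `k[P]` over `k[Q]` followed by the augmentation `ε`. It is
  -- semilinear along `ε`, so it kills the ideal, but it sends the monomial of `s₀` to `1`.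
  let wt : P → k := fun p => if s p = s₀ then ε (AddMonoidAlgebra.single (q p) 1) else 0
  let L : AddMonoidAlgebra k P →+ k :=
    (Finsupp.liftAddHom fun p => AddMonoidHom.mulRight (wt p)).comp
      (AddMonoidAlgebra.coeffAddEquiv (R := k) (M := P)).toAddMonoidHom
  have hL1 : ∀ p c, L (AddMonoidAlgebra.single p c) = c * wt p := by
    intro p c
    change (Finsupp.liftAddHom fun p => AddMonoidHom.mulRight (wt p)) (Finsupp.single p c) = _
    simp
  have hwt : ∀ a p, wt (h a + p) = ε (AddMonoidAlgebra.single a 1) * wt p := by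
    intro a p
    simp only [wt, (hqs a p).1, (hqs a p).2]
    split_ifs
    · rw [← map_mul, AddMonoidAlgebra.single_mul_single, one_mul]
    · rw [mul_zero]
  have hL : ∀ (a : AddMonoidAlgebra k Q) (x : AddMonoidAlgebra k P),
      L (algMap k h a * x) = ε a * L x := by
    intro a x
    induction x using AddMonoidAlgebra.induction_linear with
    | zero => simp
    | add x y hx hy => rw [mul_add, map_add, map_add, hx, hy, mul_add]
    | single p c =>
      induction a using AddMonoidAlgebra.induction_linear with
      | zero => simp
      | add a b ha hb => rw [map_add, add_mul, map_add, ha, hb, map_add, add_mul]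
      | single b d =>
        rw [algMap_single, AddMonoidAlgebra.single_mul_single, hL1, hL1, hwt]
        have : AddMonoidAlgebra.single b d = d • AddMonoidAlgebra.single b (1 : k) := by simp
        rw [this, map_smul, smul_eq_mul]
        ring
  intro hmem
  have key : ∀ x ∈ (RingHom.ker (unitAugmentation k Q)).map (algMap k h), ∀ y, L (y * x) = 0 := by
    intro x hx
    induction hx using Submodule.span_induction with
    | mem x hx =>
      obtain ⟨a, ha, rfl⟩ := hx
      intro y
      rw [mul_comm, hL, show ε a = 0 from ha, zero_mul]
    | zero => simp
    | add x y _ _ hx hy => intro z; rw [mul_add, map_add, hx, hy, add_zero]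
    | smul a x _ hx => intro y; rw [smul_eq_mul, ← mul_assoc, hx]
  have h1 := key _ hmem 1
  rw [one_mul, hL1, one_mul] at h1
  simp only [wt, hs₀'.1, hs₀'.2, if_true, ε] at h1
  rw [unitAugmentation_single, if_pos isAddUnit_zero] at h1
  exact one_ne_zero h1

theorem exists_basis_of_isFiniteEtale [IsCancelAdd Q] [IsCancelAdd P]
    (hu : Function.Injective (AddUnits.map h)) (hk : IsFiniteEtale (algMap k h)) :
    ∃ S : Set P, S.Finite ∧ (∀ s ∈ S, IsAddUnit s) ∧ IsBasisFor h S := by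
  have hfin := isFiniteHom_of_finite_algMap hk.1
  have hflat : (algMap k h).Flat := by
    have := hk.2
    algebraize [algMap k h]
    exact inferInstanceAs (Module.Flat (AddMonoidAlgebra k Q) (AddMonoidAlgebra k P))
  obtain ⟨S, hSfin, hS⟩ := (isEquationallyFlat_of_flat_algMap hflat).exists_isBasisFor
    (injective_of_flat_algMap hfin hflat hu) hfin
  refine ⟨S, hSfin, fun s hs => ?_, hS⟩
  by_contra hsu
  obtain ⟨n, hn, q, hq⟩ := hfin.exists_nsmul_eq s
  have hqu : ¬ IsAddUnit q := by
    intro hqu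
    obtain ⟨m, rfl⟩ := Nat.exists_eq_add_of_lt hn
    rw [zero_add, succ_nsmul'] at hq
    exact hsu (isAddUnit_of_add (hq ▸ hqu.map h))
  have hmax : (RingHom.ker (unitAugmentation k Q)).IsMaximal :=
    RingHom.ker_isMaximal_of_surjective _ fun c => ⟨AddMonoidAlgebra.single 0 c, by
      rw [unitAugmentation_single, if_pos isAddUnit_zero]⟩
  have hred : ((RingHom.ker (unitAugmentation k Q)).map (algMap k h)).IsRadical := by
    have := hk.1
    have := hk.2
    algebraize [algMap k h]
    rw [Ideal.isRadical_iff_quotient_reduced]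
    exact isReduced_quotient_map (B := AddMonoidAlgebra k P) _
  -- The `n`-th power of the monomial of `s` is the image of the monomial of the nonunit `q`, on
  -- which the augmentation vanishes; the ideal is radical because the fibre is reduced.
  refine hS.single_notMem_map_ker (k := k) hs (hred ⟨n, ?_⟩)
  rw [AddMonoidAlgebra.single_pow, one_pow, hq, ← algMap_single]
  refine Ideal.mem_map_of_mem _ ?_
  rw [RingHom.mem_ker]
  exact (unitAugmentation_single q 1).trans (if_neg hqu)

end Algebra

/-! ### Roots of units and square-zero ideals -/

/-- At `n = 0` the truncated exponent `n - 1` is harmless, as its coefficient is zero. -/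
theorem add_pow_of_sq_eq_zero {C : Type*} [CommRing C] {x : C} (hx : x ^ 2 = 0) (b : C) (n : ℕ) :
    (b + x) ^ n = b ^ n + n * b ^ (n - 1) * x := by
  induction n with
  | zero => simp
  | succ n ih =>
    rcases n with _ | n
    · simp
    · rw [pow_succ, ih]
      simp only [Nat.add_sub_cancel, Nat.cast_add, Nat.cast_one]
      linear_combination (↑n + 1) * b ^ n * hx

theorem sq_eq_zero_of_mem {C : Type*} [CommRing C] {I : Ideal C} (hI : I ^ 2 = ⊥) {x : C}
    (hx : x ∈ I) : x ^ 2 = 0 := by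
  have := Ideal.pow_mem_pow hx 2
  rwa [hI, Ideal.mem_bot] at this

/-- The difference `a ^ n - b ^ n` is the unit `n * b ^ (n - 1)` times `a - b`. -/
theorem eq_of_pow_eq_of_sub_mem {C : Type*} [CommRing C] {I : Ideal C} (hI : I ^ 2 = ⊥) {n : ℕ}
    (hn : IsUnit (n : C)) {a b : C} (hb : IsUnit b) (hab : a - b ∈ I) (e : a ^ n = b ^ n) :
    a = b := by
  have h1 := add_pow_of_sq_eq_zero (sq_eq_zero_of_mem hI hab) b n
  rw [add_sub_cancel, e, left_eq_add, (hn.mul (hb.pow _)).mul_right_eq_zero] at h1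
  exact sub_eq_zero.1 h1

/-- A single Newton step from `c` is exact, since the error is quadratic in an element of `I`. -/
theorem exists_pow_eq_of_sub_mem {C : Type*} [CommRing C] {I : Ideal C} (hI : I ^ 2 = ⊥) {n : ℕ}
    (hn : IsUnit (n : C)) {c d : C} (hc : IsUnit c) (hcd : c ^ n - d ∈ I) :
    ∃ a, a - c ∈ I ∧ a ^ n = d := by
  obtain ⟨w, hw⟩ := (hn.mul (hc.pow (n - 1))).exists_right_inv
  have hx : -(w * (c ^ n - d)) ∈ I := I.neg_mem (I.mul_mem_left _ hcd)
  refine ⟨c + -(w * (c ^ n - d)), by simpa using hx, ?_⟩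
  rw [add_pow_of_sq_eq_zero (sq_eq_zero_of_mem hI hx)]
  linear_combination -(c ^ n - d) * hw

theorem isUnit_of_isUnit_mk {C : Type*} [CommRing C] {I : Ideal C} (hI : I ^ 2 = ⊥) {c : C}
    (hc : IsUnit (Ideal.Quotient.mk I c)) : IsUnit c := by
  obtain ⟨b, hb⟩ := hc.exists_right_inv
  obtain ⟨b, rfl⟩ := Ideal.Quotient.mk_surjective b
  rw [← map_mul, ← map_one (Ideal.Quotient.mk I), Ideal.Quotient.mk_eq_mk_iff_sub_mem] at hb
  have h2 := sq_eq_zero_of_mem hI hb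
  -- `c * b * (2 - c * b) = 1 - (c * b - 1) ^ 2`, and the square vanishes.
  exact IsUnit.of_mul_eq_one (b * (2 - c * b)) (by linear_combination -h2)

/-! ### Finiteness and étaleness of `k[h]` from a basis of units -/

section Algebra

variable {Q P : Type u} [AddCommMonoid Q] [AddCommMonoid P] {h : Q →+ P} {S : Set P}
  {k : Type v} [Field k]

theorem IsBasisFor.finite_algMap (hS : IsBasisFor h S) (hfin : S.Finite) :
    (algMap k h).Finite := by
  algebraize [algMap k h]
  change Module.Finite (AddMonoidAlgebra k Q) (AddMonoidAlgebra k P)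
  refine Module.finite_def.2 ?_
  have := Submodule.fg_span (R := AddMonoidAlgebra k Q)
    (hfin.image fun s => AddMonoidAlgebra.single s (1 : k))
  convert this
  refine (Submodule.eq_top_iff'.2 fun x => ?_).symm
  induction x using AddMonoidAlgebra.induction_linear with
  | zero => exact zero_mem _
  | add x y hx hy => exact add_mem hx hy
  | single p c =>
    obtain ⟨q, s, hs, rfl⟩ := hS.exists_rep p
    have : AddMonoidAlgebra.single (h q + s) c =
        AddMonoidAlgebra.single q c • AddMonoidAlgebra.single s (1 : k) := by
      rw [Algebra.smul_def, RingHom.algebraMap_toAlgebra, algMap_single,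
        AddMonoidAlgebra.single_mul_single, mul_one]
    rw [this]
    exact Submodule.smul_mem _ _ (Submodule.subset_span ⟨s, hs, rfl⟩)

theorem algMap_injective (hinj : Function.Injective h) : Function.Injective (algMap k h) := by
  intro x y e
  rw [algMap, AddMonoidAlgebra.mapDomainRingHom_apply,
    AddMonoidAlgebra.mapDomainRingHom_apply] at e
  exact AddMonoidAlgebra.mapDomain_injective hinj e

theorem IsBasisFor.ringHom_ext {D : Type*} [CommRing D] (hS : IsBasisFor h S)
    (hu : ∀ s ∈ S, IsAddUnit s) {F G : AddMonoidAlgebra k P →+* D}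
    (e : F.comp (algMap k h) = G.comp (algMap k h))
    (e' : ∀ v : AddUnits P, F (AddMonoidAlgebra.single (v : P) 1) =
      G (AddMonoidAlgebra.single (v : P) 1)) : F = G := by
  refine RingHom.ext fun x => ?_
  induction x using AddMonoidAlgebra.induction_linear with
  | zero => rw [map_zero, map_zero]
  | add x y hx hy => rw [map_add, map_add, hx, hy]
  | single p c =>
    obtain ⟨q, s, hs, rfl⟩ := hS.exists_rep p
    obtain ⟨v, rfl⟩ := hu s hs
    have h1 : AddMonoidAlgebra.single (h q + (v : P)) c =
        algMap k h (AddMonoidAlgebra.single q c) * AddMonoidAlgebra.single (v : P) 1 := by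
      rw [algMap_single, AddMonoidAlgebra.single_mul_single, mul_one]
    have h2 : F (algMap k h (AddMonoidAlgebra.single q c)) =
        G (algMap k h (AddMonoidAlgebra.single q c)) :=
      congrArg (fun f => f (AddMonoidAlgebra.single q c)) e
    rw [h1, map_mul, map_mul, h2, e']

theorem isUnit_single (v : AddUnits P) : IsUnit (AddMonoidAlgebra.single (v : P) (1 : k)) :=
  IsUnit.of_mul_eq_one (AddMonoidAlgebra.single ((-v : AddUnits P) : P) 1) (by
    rw [AddMonoidAlgebra.single_mul_single, AddUnits.add_neg, one_mul]; rfl)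

/-- A ring map on `k[Q]` together with a compatible map on the units of `P` extends to `k[P]`. -/
theorem IsBasisFor.exists_ringHom {C : Type*} [CommRing C] (hS : IsBasisFor h S)
    (hu : ∀ s ∈ S, IsAddUnit s) (f : AddMonoidAlgebra k Q →+* C) (g : AddUnits P → C)
    (hg : ∀ v v', g (v + v') = g v * g v')
    (hfg : ∀ u : AddUnits Q, g (AddUnits.map h u) = f (AddMonoidAlgebra.single (u : Q) 1)) :
    ∃ F : AddMonoidAlgebra k P →+* C, F.comp (algMap k h) = f ∧
      ∀ v : AddUnits P, F (AddMonoidAlgebra.single (v : P) 1) = g v := by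
  have hg0 : g 0 = 1 := by
    have := hfg 0
    rw [map_zero] at this
    rw [this]
    exact map_one f
  obtain ⟨Φ, hΦ, hΦ'⟩ := hS.exists_lift (T := Additive C) hu
    { toFun := fun q => Additive.ofMul (f (AddMonoidAlgebra.single q 1))
      map_zero' := congrArg Additive.ofMul (map_one f)
      map_add' := fun a b => by
        rw [← ofMul_mul, ← map_mul, AddMonoidAlgebra.single_mul_single, one_mul] }
    { toFun := fun v => Additive.ofMul (g v)
      map_zero' := congrArg Additive.ofMul hg0
      map_add' := fun a b => by rw [hg, ofMul_mul] }
    (fun u => congrArg Additive.ofMul (hfg u))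
  let m : Multiplicative P →* C :=
    { toFun := fun p => (Φ p.toAdd).toMul
      map_one' := by rw [toAdd_one, map_zero]; rfl
      map_mul' := fun a b => by rw [toAdd_mul, map_add]; rfl }
  let F : AddMonoidAlgebra k P →+* C :=
    AddMonoidAlgebra.liftNCRingHom (f.comp AddMonoidAlgebra.singleZeroRingHom) m
      fun _ _ => Commute.all _ _
  have hF : ∀ p c, F (AddMonoidAlgebra.single p c) =
      f (AddMonoidAlgebra.single 0 c) * (Φ p).toMul := fun p c =>
    AddMonoidAlgebra.liftNC_single _ _ _ _
  have hf1 : f (AddMonoidAlgebra.single 0 1) = 1 := map_one f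
  refine ⟨F, ?_, fun v => ?_⟩
  · refine AddMonoidAlgebra.ringHom_ext (fun c => ?_) fun q => ?_
    · rw [RingHom.comp_apply, algMap_single, hF, map_zero, map_zero]
      exact mul_one _
    · rw [RingHom.comp_apply, algMap_single, hF, hf1, one_mul, hΦ]
      rfl
  · rw [hF, hf1, one_mul, hΦ']
    rfl

theorem IsBasisFor.etale_algMap [CharZero k] (hQ : AddMonoid.FG Q) (hS : IsBasisFor h S)
    (hu : ∀ s ∈ S, IsAddUnit s) (hfin : S.Finite) : (algMap k h).Etale := by
  have hfin' := hS.finite_algMap (k := k) hfin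
  algebraize [algMap k h]
  have hmap : algebraMap (AddMonoidAlgebra k Q) (AddMonoidAlgebra k P) = algMap k h := rfl
  have : IsNoetherianRing (AddMonoidAlgebra k Q) := Algebra.FiniteType.isNoetherianRing k _
  have hfp : Algebra.FinitePresentation (AddMonoidAlgebra k Q) (AddMonoidAlgebra k P) :=
    Algebra.FinitePresentation.of_finiteType.1 inferInstance
  have hfe : Algebra.FormallyEtale (AddMonoidAlgebra k Q) (AddMonoidAlgebra k P) := by
    have := hS.finite_quotient_units hu hfin
    -- `n` is the order of `P*/h(Q*)`, so the monomial of every unit of `P` is an `n`-th root of a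
    -- monomial from `Q*`.
    obtain ⟨n, hn0, hn⟩ : ∃ n : ℕ, n ≠ 0 ∧ ∀ v : AddUnits P, ∃ u : AddUnits Q,
        AddUnits.map h u = n • v := by
      refine ⟨Nat.card (AddUnits P ⧸ (AddUnits.map h).range), Nat.card_pos.ne', fun v => ?_⟩
      have : Nat.card (AddUnits P ⧸ (AddUnits.map h).range) •
          (v : AddUnits P ⧸ (AddUnits.map h).range) = 0 := card_nsmul_eq_zero'
      rw [← QuotientAddGroup.mk_nsmul, QuotientAddGroup.eq_zero_iff] at this
      exact this
    choose root hroot using hn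
    have hroot' : ∀ v : AddUnits P, h (root v) = n • (v : P) := fun v => by
      simpa using congrArg (fun w : AddUnits P => (w : P)) (hroot v)
    have hpow : ∀ v : AddUnits P, AddMonoidAlgebra.single (v : P) (1 : k) ^ n =
        algMap k h (AddMonoidAlgebra.single (root v : Q) 1) := fun v => by
      rw [AddMonoidAlgebra.single_pow, one_pow, algMap_single, hroot']
    have hinj := hS.injective
    refine Algebra.FormallyEtale.iff_comp_bijective.2 fun C _ _ I hI => ?_
    -- Characteristic zero enters here: `C` is a `k`-algebra and `n ≠ 0` in `k`.
    have hnC : IsUnit (n : C) := by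
      have h1 : IsUnit (n : k) := (Nat.cast_ne_zero.2 hn0).isUnit
      simpa using h1.map ((algebraMap (AddMonoidAlgebra k Q) C).comp
        (algebraMap k (AddMonoidAlgebra k Q)))
    constructor
    · intro F G e
      refine AlgHom.coe_ringHom_injective (hS.ringHom_ext hu ?_ fun v => ?_)
      · rw [← hmap]
        exact (F.comp_algebraMap).trans (G.comp_algebraMap).symm
      · refine eq_of_pow_eq_of_sub_mem hI hnC ((isUnit_single v).map _) ?_ ?_
        · rw [← Ideal.Quotient.mk_eq_mk_iff_sub_mem]
          exact congrArg (fun f => f (AddMonoidAlgebra.single (v : P) 1)) e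
        · rw [← map_pow, ← map_pow, hpow, ← hmap]
          exact (F.commutes _).trans (G.commutes _).symm
    · intro f
      let ψ : AddMonoidAlgebra k Q →+* C := algebraMap _ _
      have hfψ : ∀ a, f (algMap k h a) = Ideal.Quotient.mk I (ψ a) := fun a => f.commutes a
      -- The image of each unit monomial lifts to an `n`-th root in `C` of the value prescribed by
      -- `ψ`.
      have hex : ∀ v : AddUnits P, ∃ a : C,
          Ideal.Quotient.mk I a = f (AddMonoidAlgebra.single (v : P) 1) ∧
          a ^ n = ψ (AddMonoidAlgebra.single (root v : Q) 1) := by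
        intro v
        obtain ⟨c, hc⟩ := Ideal.Quotient.mk_surjective (f (AddMonoidAlgebra.single (v : P) 1))
        have hcu : IsUnit c := isUnit_of_isUnit_mk hI (hc ▸ (isUnit_single v).map f)
        obtain ⟨a, ha, ha'⟩ := exists_pow_eq_of_sub_mem hI hnC hcu
          (d := ψ (AddMonoidAlgebra.single (root v : Q) 1)) (by
            rw [← Ideal.Quotient.mk_eq_mk_iff_sub_mem, ← hfψ, map_pow, hc, ← map_pow, hpow])
        exact ⟨a, by rw [← hc]; exact Ideal.Quotient.mk_eq_mk_iff_sub_mem _ _ |>.2 ha, ha'⟩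
      choose g hg hg' using hex
      -- Uniqueness of the lifted roots makes `g` multiplicative and compatible with `ψ` on `Q*`, so
      -- that `g` and `ψ` glue to a ring map on `k[P]`.
      have huniq : ∀ (v : AddUnits P) (a : C),
          Ideal.Quotient.mk I a = f (AddMonoidAlgebra.single (v : P) 1) →
          a ^ n = ψ (AddMonoidAlgebra.single (root v : Q) 1) → g v = a := by
        intro v a ha ha'
        refine eq_of_pow_eq_of_sub_mem hI hnC
          (isUnit_of_isUnit_mk hI (ha ▸ (isUnit_single v).map f)) ?_ ((hg' v).trans ha'.symm)
        rw [← Ideal.Quotient.mk_eq_mk_iff_sub_mem, hg, ha]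
      have hroot_add : ∀ v v' : AddUnits P, (root (v + v') : Q) = root v + root v' := by
        intro v v'
        refine hinj ?_
        rw [map_add, hroot', hroot', hroot', AddUnits.val_add, nsmul_add]
      have hroot_map : ∀ u : AddUnits Q, (root (AddUnits.map h u) : Q) = n • (u : Q) := by
        intro u
        refine hinj ?_
        rw [hroot', map_nsmul]; rfl
      obtain ⟨F, hF, hF'⟩ := hS.exists_ringHom hu ψ g
        (fun v v' => by
          refine huniq _ _ ?_ ?_
          · rw [map_mul, hg, hg, ← map_mul, AddMonoidAlgebra.single_mul_single, one_mul,
              AddUnits.val_add]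
          · rw [mul_pow, hg', hg', ← map_mul, AddMonoidAlgebra.single_mul_single, one_mul,
              hroot_add])
        (fun u => by
          refine huniq _ _ ?_ ?_
          · rw [← hfψ, algMap_single]; rfl
          · rw [← map_pow, AddMonoidAlgebra.single_pow, one_pow, hroot_map])
      refine ⟨{ F with commutes' := fun a => congrArg (fun φ => φ a) hF }, ?_⟩
      refine AlgHom.coe_ringHom_injective (hS.ringHom_ext hu ?_ fun v => ?_)
      · ext a
        · change Ideal.Quotient.mk I (F.comp (algMap k h) _) = f (algMap k h _)
          rw [hF, hfψ]
        · change Ideal.Quotient.mk I (F.comp (algMap k h) _) = f (algMap k h _)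
          rw [hF, hfψ]
      · change Ideal.Quotient.mk I (F _) = f _
        rw [hF', hg]
  exact ⟨hfe, hfp⟩

/-! ### Finite étale covers -/

theorem isFiniteEtaleCover_specAlgMap_iff : IsFiniteEtaleCover (specAlgMap k h) ↔
    IsFiniteEtale (algMap k h) ∧ Function.Surjective (PrimeSpectrum.comap (algMap k h)) := by
  rw [IsFiniteEtaleCover, specAlgMap, AlgebraicGeometry.IsFinite.SpecMap_iff,
    AlgebraicGeometry.HasRingHomProperty.Spec_iff (P := @AlgebraicGeometry.Etale),
    AlgebraicGeometry.surjective_iff, IsFiniteEtale, and_assoc]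
  rfl

theorem IsBasisFor.isFiniteEtaleCover [CharZero k] (hQ : AddMonoid.FG Q) (hS : IsBasisFor h S)
    (hu : ∀ s ∈ S, IsAddUnit s) (hfin : S.Finite) : IsFiniteEtaleCover (specAlgMap k h) :=
  isFiniteEtaleCover_specAlgMap_iff.2
    ⟨⟨hS.finite_algMap hfin, hS.etale_algMap hQ hu hfin⟩,
      (hS.finite_algMap hfin).to_isIntegral.comap_surjective (algMap_injective hS.injective)⟩

/-- Étale maps are flat, and flat with surjective spectrum means faithfully flat, so `k[h]` is
injective; monomials then separate elements of `Q`. -/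
theorem injective_of_surjective_comap (hk : (algMap k h).Etale)
    (hsurj : Function.Surjective (PrimeSpectrum.comap (algMap k h))) : Function.Injective h := by
  have hinj : Function.Injective (algMap k h) := by
    algebraize [algMap k h]
    have : Module.FaithfullyFlat (AddMonoidAlgebra k Q) (AddMonoidAlgebra k P) :=
      .of_comap_surjective hsurj
    exact FaithfulSMul.algebraMap_injective (AddMonoidAlgebra k Q) (AddMonoidAlgebra k P)
  intro q q' e
  refine AddMonoidAlgebra.single_left_injective (one_ne_zero (α := k)) (hinj ?_)
  rw [algMap_single, algMap_single, e]

end Algebra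

end CZE

/-! ### The equivalences -/

theorem mainTheorem5 {Q P : Type u} [AddCommMonoid Q] [AddCommMonoid P]
    (hQ : CZE.IsFine Q) (hP : CZE.IsFine P) (h : Q →+ P) :
    List.TFAE [
      -- (1) the map of unit groups is injective with finite cokernel, and the square is a pushout
      Function.Injective (AddUnits.map h) ∧
        Finite (AddUnits P ⧸ (AddUnits.map h).range) ∧
        IsPushout
          (AddCommMonCat.ofHom (AddUnits.map h))
          (AddCommMonCat.ofHom (AddUnits.coeHom Q))
          (AddCommMonCat.ofHom (AddUnits.coeHom P))
          (AddCommMonCat.ofHom h),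
      -- (2)
      Function.Injective h ∧ Function.Bijective (CZE.sharpeningMap h) ∧ Finite (CZE.Coker h),
      -- (3)
      ∃ S : Set P, S.Finite ∧ (∀ s ∈ S, IsAddUnit s) ∧ CZE.IsBasisFor h S ∧
        ∀ S' : Set P, CZE.IsBasisFor h S' →
          (∀ s ∈ S', IsAddUnit s) ∧ Cardinal.mk S' = Cardinal.mk S,
      -- (4)
      ∃ S : Set P, S.Finite ∧ (∀ s ∈ S, IsAddUnit s) ∧ CZE.IsBasisFor h S,
      -- (5)
      IsHomeomorph (CZE.specMap h) ∧
        ∀ (k : Type v) [Field k] [CharZero k], CZE.IsFiniteEtaleCover (CZE.specAlgMap k h),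
      -- (6)
      ∀ (k : Type v) [Field k] [CharZero k], CZE.IsFiniteEtaleCover (CZE.specAlgMap k h),
      -- (7)
      ∃ (k : Type v) (_ : Field k), CZE.IsFiniteEtaleCover (CZE.specAlgMap k h),
      -- (7')
      Function.Injective (AddUnits.map h) ∧
        ∃ (k : Type v) (_ : Field k), CZE.IsFiniteEtale (CZE.algMap k h),
      -- (8)
      CZE.IsFiniteHom h ∧ CZE.IsFlatHom h ∧ CZE.IsReducedHom h ∧ CZE.IsLocalMap h,
      -- (9)
      CZE.IsFiniteHom h ∧ CZE.IsFlatHom h ∧ CZE.IsReducedHom h] := by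
  have := hQ.isCancelAdd
  have := hP.isCancelAdd
  tfae_have 1 → 4 := fun ⟨h1, h2, h3⟩ => CZE.exists_basis_of_isPushout h1 h2 h3
  tfae_have 2 → 4 := fun ⟨h1, h2, h3⟩ => CZE.exists_basis_of_bijective_sharpeningMap h1 h2 h3
  tfae_have 3 → 4 := fun ⟨S, h1, h2, h3, _⟩ => ⟨S, h1, h2, h3⟩
  tfae_have 4 → 1 := fun ⟨_, hfin, hu, hS⟩ =>
    ⟨fun u u' e => AddUnits.ext (hS.injective (congrArg AddUnits.val e)),
      hS.finite_quotient_units hu hfin, hS.isPushout hu⟩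
  tfae_have 4 → 2 := fun ⟨_, hfin, hu, hS⟩ =>
    ⟨hS.injective, hS.bijective_sharpeningMap hu, hS.finite_coker hfin⟩
  tfae_have 4 → 3 := fun ⟨S, hfin, hu, hS⟩ => ⟨S, hfin, hu, hS, fun _ hS' =>
    have hu' := hS.isAddUnit_of_isBasisFor hu hS'
    ⟨hu', le_antisymm (hS.mk_le_mk hu hS') (hS'.mk_le_mk hu' hS)⟩⟩
  tfae_have 4 → 5 := fun ⟨_, hfin, hu, hS⟩ =>
    ⟨hS.isHomeomorph_specMap hu, fun _ _ _ => hS.isFiniteEtaleCover hQ.fg hu hfin⟩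
  tfae_have 5 → 6 := fun ⟨_, h⟩ => h
  -- `ULift ℚ` is a field of characteristic zero in the universe `v`.
  tfae_have 6 → 7 := fun h => ⟨ULift ℚ, inferInstance,
    have : CharZero (ULift.{v} ℚ) :=
      ⟨fun _ _ e => Nat.cast_injective (R := ℚ) (congrArg ULift.down e)⟩
    h _⟩
  tfae_have 7 → 8 := fun ⟨k, _, hk⟩ => by
    obtain ⟨hfe, hsurj⟩ := CZE.isFiniteEtaleCover_specAlgMap_iff.1 hk
    have hinj := CZE.injective_of_surjective_comap hfe.2 hsurj
    exact ⟨fun u u' e => AddUnits.ext (hinj (congrArg AddUnits.val e)), k, _, hfe⟩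
  tfae_have 8 → 4 := fun ⟨hu, _, _, hk⟩ => CZE.exists_basis_of_isFiniteEtale hu hk
  tfae_have 4 → 9 := fun ⟨_, hfin, hu, hS⟩ =>
    ⟨hS.isFiniteHom hfin, hS.isFlatHom, hS.isReducedHom hu, hS.isLocalMap⟩
  tfae_have 9 → 10 := fun ⟨h1, h2, h3, _⟩ => ⟨h1, h2, h3⟩
  tfae_have 10 → 4 := fun ⟨h1, h2, h3⟩ => CZE.exists_basis_of_isReducedHom h1 h2 h3
  tfae_finish
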